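/- **Setting.** Let $n\ge 1$ and let $b_{ij}\ge 0$ ($1\le i,j\le n$, $b_{ii}=0$) be the weights of a digraph with edges $(i,j)$ where $b_{ij}>0$, having a globally reachable node (a node reachable from every node along directed edges). Let $L$ be its Laplacian, $[L]_{ii}=\sum_j b_{ij}$, $[L]_{ij}=-b_{ij}$ for $i\neq j$. Let $k_p,k_d,\gamma_p,\gamma_d\ge 0$ with $(k_p,\gamma_p)\ne(0,0)$ and $(k_d,\gamma_d)\neq(0,0)$, and consider $$\begin{bmatrix}\dot{\mathbf x}\\ \dot{\mathbf v}\end{bmatrix}=\begin{bmatrix}0&I\\-k_pI-\gamma_pL&-k_dI-\gamma_dL\end{bmatrix}\begin{bmatrix}\mathbf x\\ \mathbf v\end{bmatrix}+\begin{bmatrix}0\\ I\end{bmatrix}\mathbf w ,$$ with output $\mathbf y=C\mathbf x$ (position case, $r(s)=1$) or $\mathbf y=C\mathbf v$ (velocity case, $r(s)=s$), where $C\in\mathbb R^{q\times n}$ and $C\mathbf 1=\mathbf 0$. Let $T(t)$ be the impulse response from $\mathbf w$ to $\mathbf y$, and assume that $T$ is input-output stable, i.e. its entries are absolutely integrable on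 $(0,\infty)$. For $\mathbf w_0\in\mathbb R^n$ and $\mathbf w(t)=\mathbf w_0\delta(t)$, zero initial state, one has $\mathbf y(t)=T(t)\mathbf w_0$; put $P=\int_0^\infty \mathbf y(t)^*\mathbf y(t)\,dt$. Let $L=RJR^{-1}$ be any Jordan decomposition over $\mathbb C$ with (upper triangular) Jordan blocks $J_1,\dots,J_m$, $J_k$ of size $n_k$ with eigenvalue $\lambda_k$, numbered so that $\lambda_1=0$. Let $\tilde R$ be the columns of $R$ and $\tilde Q$ the rows of $R^{-1}$ belonging to the blocks $2,\dots,m$; write $\mathbf r_{(k,p)}$ for the $p$-th column of $R$ in block $k$. Block $k\ge2$ is *observable* if $C\mathbf r_{(k,p)}\neq 0$ for some $p$. Let $\tilde H_k(t)=[\tilde h^{(k)}_{pq}(t)]$ be the impulse response matrix of the $k$-th subsystem, i.e. the inverse Laplace transform of $r(s)\left[(s^2+k_ds+k_p)I+(\gamma_p+s\gamma_d)J_k\right]^{-1}$. Let $C^*C=\Theta\,\mathrm{diag}(\mu_1,\dots,\mu_n)\,\Theta^*$ with $\Theta=[\boldsymbol\theta_1,\dots,\boldsymbol\theta_n]$ unitary,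 $\mu_i\in\mathbb R$, $\mu_1=0$, $\boldsymbol\theta_1=\frac1{\sqrt n}\mathbf 1$, and put $$\nu_{\eta,\kappa}=\sum_{i=2}^n(\mathbf r_\eta^*\boldsymbol\theta_i)(\boldsymbol\theta_i^*\mathbf r_\kappa)\mu_i ,\qquad \Sigma_Q=\tilde Q\mathbf w_0\mathbf w_0^*\tilde Q^* ,$$ $$[\Psi_{kl}]_{qb}=\sum_{p=1}^q\sum_{a=1}^b\nu_{(k,p),(l,a)}\big\langle\tilde h^{(l)}_{ab},\tilde h^{(k)}_{pq}\big\rangle,\qquad \big\langle\tilde h^{(l)}_{ab},\tilde h^{(k)}_{pq}\big\rangle=\int_0^\infty\overline{\tilde h^{(k)}_{pq}(t)}\,\tilde h^{(l)}_{ab}(t)\,dt ,$$ for $2\le k,l\le m$, and $\Psi=[\Psi_{kl}]$. (If $k$ or $l$ is not observable then $\nu_{(k,p),(l,a)}=0$, and the term is read as $0$ even if the integral diverges.) Let $\rho_1^{(k)},\rho_2^{(k)}$ be the roots, with multiplicity, of $s^2+(k_d+\gamma_d\lambda_k)s+k_p+\gamma_p\lambda_k=0$. **Theorem.** $P$ is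 finite and $P=\mathrm{tr}(\Sigma_Q\Psi)$. For every observable block $k$ both roots $\rho_1^{(k)},\rho_2^{(k)}$ have negative real part. For all $k,l\in\{2,\dots,m\}$ whose roots all have negative real part, and all $1\le p\le q\le n_k$, $1\le a\le b\le n_l$, the integral $\langle\tilde h^{(l)}_{ab},\tilde h^{(k)}_{pq}\rangle$ converges absolutely and, with $\sigma=q-p+1$, $\upsilon=b-a+1$ and $$\Phi_{\zeta r}(\sigma,\upsilon)=(-1)^{1-\zeta-r}\frac{(\sigma+\upsilon-\zeta-r)!}{(\sigma-\zeta)!\,(\upsilon-r)!},$$ it is equal to the following. 1. If $\rho_1^{(k)}\ne\rho_2^{(k)}$ and $\rho_1^{(l)}\neq\rho_2^{(l)}$: $$\sum_{\zeta=1}^{\sigma}\sum_{r=1}^{\upsilon}\ \sum_{i=1}^2\sum_{j=1}^2\frac{\Phi_{\zeta r}(\sigma,\upsilon)\,\overline{c^{(k)}_{\zeta+(i-1)\sigma}}\,c^{(l)}_{r+(j-1)\upsilon}}{\big(\overline{\rho_i^{(k)}}+\rho_j^{(l)}\big)^{\sigma+\upsilon-\zeta-r+1}} .$$ 2. If $\rho_1^{(k)}\ne\rho_2^{(k)}$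 and $\rho_1^{(l)}=\rho_2^{(l)}=\rho^{(l)}$: $$\sum_{\zeta=1}^{\sigma}\sum_{r=1}^{2\upsilon}\ \sum_{i=1}^2\frac{(-1)^{\upsilon}\Phi_{\zeta r}(\sigma,2\upsilon)\,\overline{c^{(k)}_{\zeta+(i-1)\sigma}}\,c^{(l)}_{r}}{\big(\overline{\rho_i^{(k)}}+\rho^{(l)}\big)^{\sigma+2\upsilon-\zeta-r+1}} .$$ 3. If $\rho_1^{(k)}=\rho_2^{(k)}=\rho^{(k)}$ and $\rho_1^{(l)}\neq\rho_2^{(l)}$: $$\sum_{\zeta=1}^{2\sigma}\sum_{r=1}^{\upsilon}\ \sum_{j=1}^2\frac{(-1)^{\sigma}\Phi_{\zeta r}(2\sigma,\upsilon)\,\overline{c^{(k)}_{\zeta}}\,c^{(l)}_{r+(j-1)\upsilon}}{\big(\overline{\rho^{(k)}}+\rho_j^{(l)}\big)^{2\sigma+\upsilon-\zeta-r+1}} .$$ 4. If $\rho_1^{(k)}=\rho_2^{(k)}=\rho^{(k)}$ and $\rho_1^{(l)}=\rho_2^{(l)}=\rho^{(l)}$: $$\sum_{\zeta=1}^{2\sigma}\sum_{r=1}^{2\upsilon}\frac{(-1)^{\sigma+\upsilon}\Phi_{\zeta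 r}(2\sigma,2\upsilon)\,\overline{c^{(k)}_{\zeta}}\,c^{(l)}_{r}}{\big(\overline{\rho^{(k)}}+\rho^{(l)}\big)^{2\sigma+2\upsilon-\zeta-r+1}} .$$ Here the coefficients $c^{(k)}_j$, $1\le j\le 2\delta$, are taken with $\delta=\sigma$ (and $c^{(l)}_j$ with $\delta=\upsilon$) and are defined as follows, where $0^0=1$. Put $G_\zeta(\rho)=\gamma_d^{\zeta}$ in the position case and $$G_\zeta(\rho)=\frac{\zeta\gamma_p\gamma_d^{\zeta-1}+\delta\rho\gamma_d^{\zeta}}{\delta-\zeta}$$ in the velocity case (the term $\zeta\gamma_p\gamma_d^{\zeta-1}$ being $0$ for $\zeta=0$). * If $\rho_1^{(k)}\neq\rho_2^{(k)}$: for $1\le l\le\delta$, with $\tau(\zeta,l)=(-1)^{l-\zeta-1}\binom{l-1}{\zeta}\binom{\delta+l-\zeta-2}{l-1}$, $$c_l^{(k)}=\sum_{\zeta=0}^{l-1}\tau(\zeta,l)\,G_\zeta(\rho_1^{(k)})\frac{(\gamma_p+\rho_1^{(k)}\gamma_d)^{\delta-\zeta-1}}{(\rho_1^{(k)}-\rho_2^{(k)})^{\delta+l-\zeta-1}},$$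 and $c_{l+\delta}^{(k)}$ is the same expression with $\rho_1^{(k)}$ and $\rho_2^{(k)}$ interchanged. * If $\rho_1^{(k)}=\rho_2^{(k)}=\rho^{(k)}$: $c_l^{(k)}=G_{l-1}(\rho^{(k)})\binom{\delta-1}{l-1}(\gamma_p+\rho^{(k)}\gamma_d)^{\delta-l}$ for $1\le l\le\delta$; for $\delta+1\le l\le 2\delta$, $c_l^{(k)}=0$, except that $c_{\delta+1}^{(k)}=\gamma_d^{\delta-1}$ in the velocity case. -/

import Mathlib

noncomputable section

namespace DoubleIntegratorNetwork

open MeasureTheory Matrix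

/-! ### Weighted digraphs -/

/-- The weights `b i j` of a digraph on `n` nodes: `b i j > 0` exactly on the edges `(i, j)`,
`b i j = 0` otherwise, and there are no self-loops. -/
structure IsDigraphWeight {n : ℕ} (b : Matrix (Fin n) (Fin n) ℝ) : Prop where
  nonneg : ∀ i j, 0 ≤ b i j
  diag : ∀ i, b i i = 0

/-- Some node can be reached from every node along directed edges. -/
def HasGloballyReachableNode {n : ℕ} (b : Matrix (Fin n) (Fin n) ℝ) : Prop :=
  ∃ r, ∀ i, Relation.ReflTransGen (fun i j => 0 < b i j) i r

/-- The weighted graph Laplacian. -/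
def laplacian {n : ℕ} (b : Matrix (Fin n) (Fin n) ℝ) : Matrix (Fin n) (Fin n) ℝ :=
  Matrix.of fun i j => if i = j then ∑ j', b i j' else -b i j

/-! ### The double-integrator network -/

/-- The gains `k_p, k_d, γ_p, γ_d`. -/
structure Gains where
  kp : ℝ
  kd : ℝ
  γp : ℝ
  γd : ℝ

/-- Nonnegative gains with feedback in both position and velocity. -/
structure Gains.Admissible (g : Gains) : Prop where
  kp_nonneg : 0 ≤ g.kp
  kd_nonneg : 0 ≤ g.kd
  γp_nonneg : 0 ≤ g.γp
  γd_nonneg : 0 ≤ g.γd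
  position_feedback : g.kp ≠ 0 ∨ g.γp ≠ 0
  velocity_feedback : g.kd ≠ 0 ∨ g.γd ≠ 0

/-- Which state is observed: the position `x` (`r(s) = 1`) or the velocity `v = ẋ`
(`r(s) = s`). -/
inductive OutputKind
  | position
  | velocity

section System

variable {𝕜 : Type*} [RCLike 𝕜] {ι : Type*} [Fintype ι] [DecidableEq ι]

/-- The state matrix of `(ẋ, v̇) = (v, -(k_p I + γ_p L) x - (k_d I + γ_d L) v + w)`.
It is used for the graph Laplacian `L` (the network) and for a Jordan block in place of `L`
(one subsystem in the Jordan coordinates). -/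
def stateMatrix (g : Gains) (L : Matrix ι ι 𝕜) : Matrix (ι ⊕ ι) (ι ⊕ ι) 𝕜 :=
  Matrix.fromBlocks 0 1
    (-(g.kp • (1 : Matrix ι ι 𝕜)) - g.γp • L) (-(g.kd • (1 : Matrix ι ι 𝕜)) - g.γd • L)

/-- The input matrix `[0; I]`: the disturbance enters the velocity equation. -/
def inputMatrix : Matrix (ι ⊕ ι) ι 𝕜 := Matrix.fromRows 0 1

/-- `[I 0]` selects the position, `[0 I]` selects the velocity. -/
def selectMatrix : OutputKind → Matrix ι (ι ⊕ ι) 𝕜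
  | .position => Matrix.fromCols 1 0
  | .velocity => Matrix.fromCols 0 1

/-- The impulse response function from `w` to `x` (resp. to `v`), for `t ≥ 0`: the inverse Laplace
transform of `r(s) [(s² + k_d s + k_p) I + (γ_p + s γ_d) L]⁻¹` with `r(s) = 1` (resp. `r(s) = s`). -/
def impulseResponse (o : OutputKind) (g : Gains) (L : Matrix ι ι 𝕜) (t : ℝ) : Matrix ι ι 𝕜 :=
  (selectMatrix o : Matrix ι (ι ⊕ ι) 𝕜) *
    (NormedSpace.exp (t • stateMatrix g L) : Matrix (ι ⊕ ι) (ι ⊕ ι) 𝕜) *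
    (inputMatrix : Matrix (ι ⊕ ι) ι 𝕜)

end System

/-- The impulse response function `T(t)` of the network from `w` to the output `y = C x` or
`y = C v`. -/
def outputResponse {n q : ℕ} (o : OutputKind) (g : Gains) (L : Matrix (Fin n) (Fin n) ℝ)
    (C : Matrix (Fin q) (Fin n) ℝ) (t : ℝ) : Matrix (Fin q) (Fin n) ℝ :=
  C * impulseResponse o g L t

/-- Input-output stability: the impulse response function is absolutely integrable. -/
def IOStable {n q : ℕ} (T : ℝ → Matrix (Fin q) (Fin n) ℝ) : Prop :=
  ∀ i j, IntegrableOn (fun t => T t i j) (Set.Ioi 0)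

/-- The squared `L₂` norm `∫₀^∞ y(t)* y(t) dt` of an output. -/
def performance {q : ℕ} (y : ℝ → Fin q → ℝ) : ℝ :=
  ∫ t in Set.Ioi 0, y t ⬝ᵥ y t

/-! ### Jordan form of the Laplacian -/

/-- The upper triangular Jordan block of size `s` with eigenvalue `a`. -/
def jordanBlock (a : ℂ) (s : ℕ) : Matrix (Fin s) (Fin s) ℂ :=
  Matrix.of fun i j => if i = j then a else if i.val + 1 = j.val then 1 else 0

/-- A Jordan decomposition `L = R J R⁻¹` with `m + 1` Jordan blocks, numbered such that the first
block (block `0` here) belongs to the eigenvalue `0`. The pair `⟨k, p⟩` is the index of the `p`-th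
row or column of the `k`-th block. -/
structure JordanDecomposition {n : ℕ} (L : Matrix (Fin n) (Fin n) ℝ) (m : ℕ) where
  size : Fin (m + 1) → ℕ
  size_pos : ∀ k, 0 < size k
  eig : Fin (m + 1) → ℂ
  R : Matrix (Fin n) (Σ k, Fin (size k)) ℂ
  Rinv : Matrix (Σ k, Fin (size k)) (Fin n) ℂ
  R_mul_Rinv : R * Rinv = 1
  Rinv_mul_R : Rinv * R = 1
  decomp : L.map (fun x : ℝ => (x : ℂ)) =
    R * Matrix.blockDiagonal' (fun k => jordanBlock (eig k) (size k)) * Rinv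
  eig_zero : eig 0 = 0

namespace JordanDecomposition

variable {n m : ℕ} {L : Matrix (Fin n) (Fin n) ℝ} (D : JordanDecomposition L m)

/-- Row and column indices outside the first block. -/
abbrev Index : Type := Σ k : Fin m, Fin (D.size k.succ)

/-- `R̃`: the columns of `R` outside the first block. -/
def Rtilde : Matrix (Fin n) D.Index ℂ := Matrix.of fun i x => D.R i ⟨x.1.succ, x.2⟩

/-- `Q̃`: the rows of `R⁻¹` outside the first block. -/
def Qtilde : Matrix D.Index (Fin n) ℂ := Matrix.of fun x i => D.Rinv ⟨x.1.succ, x.2⟩ i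

/-- The block `k` is observable if `C R̃_k ≠ 0`, with `R̃_k` the columns of `R̃` in block `k`. -/
def IsObservable {q : ℕ} (C : Matrix (Fin q) (Fin n) ℝ) (k : Fin m) : Prop :=
  C.map (fun x : ℝ => (x : ℂ)) *
    (Matrix.of fun i p => D.Rtilde i ⟨k, p⟩ : Matrix (Fin n) (Fin (D.size k.succ)) ℂ) ≠ 0

/-- `H̃_k(t)`, with entries `h̃_{pq}^{(k)}(t)`: the impulse response function of the subsystem of
the `k`-th Jordan block. -/
def blockResponse (o : OutputKind) (g : Gains) (k : Fin m) (t : ℝ) :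
    Matrix (Fin (D.size k.succ)) (Fin (D.size k.succ)) ℂ :=
  impulseResponse o g (jordanBlock (D.eig k.succ) (D.size k.succ)) t

/-- `⟨h̃_{ab}^{(l)}, h̃_{pq}^{(k)}⟩ = ∫₀^∞ conj(h̃_{pq}^{(k)}(t)) h̃_{ab}^{(l)}(t) dt`. -/
def scalarProduct (o : OutputKind) (g : Gains) (l k : Fin m)
    (a b : Fin (D.size l.succ)) (p q : Fin (D.size k.succ)) : ℂ :=
  ∫ t in Set.Ioi (0 : ℝ), star (D.blockResponse o g k t p q) * D.blockResponse o g l t a b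

/-- `Σ_Q = Q̃ w₀ w₀* Q̃*`. -/
def sigmaQ (w₀ : Fin n → ℝ) : Matrix D.Index D.Index ℂ :=
  D.Qtilde * Matrix.vecMulVec (fun i => (w₀ i : ℂ)) (star fun i => (w₀ i : ℂ)) * D.Qtildeᴴ

/-- The scalar `ν_{η,κ} = ∑_{l ≥ 2} ⟨θ_l, r_η⟩ ⟨r_κ, θ_l⟩ μ_l`, with `⟨θ, r⟩ = r* θ`, where `θ_l` are
the columns of `Θ` and `r_η` those of `R̃`. The index `0` plays the role of `l = 1`. -/
def nu [NeZero n] (Θ : Matrix (Fin n) (Fin n) ℂ) (μ : Fin n → ℝ) (η κ : D.Index) : ℂ :=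
  ∑ l ∈ Finset.univ.erase (0 : Fin n),
    (∑ i, star (D.Rtilde i η) * Θ i l) * (∑ i, star (Θ i l) * D.Rtilde i κ) * (μ l : ℂ)

/-- The matrix `Ψ`, with entry `(q, b)` of the block `(k, l)` equal to
`∑_{p ≤ q} ∑_{a ≤ b} ν_{(k,p),(l,a)} ⟨h̃_{ab}^{(l)}, h̃_{pq}^{(k)}⟩`. -/
def Psi [NeZero n] (o : OutputKind) (g : Gains) (Θ : Matrix (Fin n) (Fin n) ℂ) (μ : Fin n → ℝ) :
    Matrix D.Index D.Index ℂ :=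
  Matrix.of fun x y => ∑ p ∈ Finset.Iic x.2, ∑ a ∈ Finset.Iic y.2,
    D.nu Θ μ ⟨x.1, p⟩ ⟨y.1, a⟩ * D.scalarProduct o g y.1 x.1 a y.2 p x.2

end JordanDecomposition

/-- A unitary diagonalization `C* C = Θ diag(μ) Θ*` in which the first eigenpair (index `0` here)
is `μ₁ = 0`, `θ₁ = 1 / √n` times the vector of ones. -/
structure IsOutputDiagonalization {n q : ℕ} [NeZero n] (C : Matrix (Fin q) (Fin n) ℝ)
    (Θ : Matrix (Fin n) (Fin n) ℂ) (μ : Fin n → ℝ) : Prop where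
  unitary : Θ * Θᴴ = 1
  decomp : (Cᵀ * C).map (fun x : ℝ => (x : ℂ)) =
    Θ * Matrix.diagonal (fun i => (μ i : ℂ)) * Θᴴ
  eigenvalue_zero : μ 0 = 0
  eigenvector_zero : ∀ i, Θ i 0 = ((1 / Real.sqrt n : ℝ) : ℂ)

/-! ### The coefficients -/

/-- `ρ₁`, `ρ₂` are the two roots, with multiplicity, of
`s² + (k_d + γ_d a) s + k_p + γ_p a = 0`. -/
def AreRoots (g : Gains) (a ρ₁ ρ₂ : ℂ) : Prop :=
  ∀ s : ℂ, s ^ 2 + (g.kd + g.γd * a) * s + (g.kp + g.γp * a) = (s - ρ₁) * (s - ρ₂)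

/-- `τ(ζ, l) = (-1)^(l-ζ-1) (l-1 choose ζ) (δ+l-ζ-2 choose l-1)`. -/
def tau (δ ζ l : ℕ) : ℂ :=
  (-1) ^ (l - ζ - 1) * ((l - 1).choose ζ : ℂ) * ((δ + l - ζ - 2).choose (l - 1) : ℂ)

/-- The factor `γ_d^ζ` (position) or `γ_d^(ζ-1) (ζ γ_p + δ ρ γ_d) / (δ - ζ)` (velocity). The latter
is written with the power of `γ_d` multiplied out, so that it also has the correct value if
`γ_d = 0`: the term `ζ γ_d^(ζ-1)` is `0` for `ζ = 0`. -/
def gainFactor (o : OutputKind) (g : Gains) (δ : ℕ) (ρ : ℂ) (ζ : ℕ) : ℂ :=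
  match o with
  | .position => (g.γd : ℂ) ^ ζ
  | .velocity =>
      ((ζ : ℂ) * (g.γd : ℂ) ^ (ζ - 1) * g.γp + (δ : ℂ) * ρ * (g.γd : ℂ) ^ ζ) / ((δ : ℂ) - ζ)

/-- The coefficient of `(s - ρ)^(-(δ-l+1))`, `1 ≤ l ≤ δ`, for the root `ρ` if the other root is
`ρ' ≠ ρ`. -/
def distinctHalf (o : OutputKind) (g : Gains) (δ : ℕ) (ρ ρ' : ℂ) (l : ℕ) : ℂ :=
  ∑ ζ ∈ Finset.range l, tau δ ζ l * gainFactor o g δ ρ ζ *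
    ((g.γp + ρ * g.γd) ^ (δ - ζ - 1) / (ρ - ρ') ^ (δ + l - ζ - 1))

/-- The coefficients `c_j`, `1 ≤ j ≤ 2δ`, for distinct roots `ρ₁ ≠ ρ₂`. -/
def coeffDistinct (o : OutputKind) (g : Gains) (δ : ℕ) (ρ₁ ρ₂ : ℂ) (j : ℕ) : ℂ :=
  if j ≤ δ then distinctHalf o g δ ρ₁ ρ₂ j else distinctHalf o g δ ρ₂ ρ₁ (j - δ)

/-- The coefficients `c_l`, `1 ≤ l ≤ 2δ`, for a repeated root `ρ`. -/
def coeffRepeated (o : OutputKind) (g : Gains) (δ : ℕ) (ρ : ℂ) (l : ℕ) : ℂ :=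
  if l ≤ δ then
    gainFactor o g δ ρ (l - 1) * ((δ - 1).choose (l - 1) : ℂ) * (g.γp + ρ * g.γd) ^ (δ - l)
  else
    match o with
    | .position => 0
    | .velocity => if l = δ + 1 then (g.γd : ℂ) ^ (δ - 1) else 0

/-- `Φ_{ζ r}(σ, υ) = (-1)^(1-ζ-r) (σ+υ-ζ-r)! / ((σ-ζ)! (υ-r)!)`. -/
def Phi (ζ r σ υ : ℕ) : ℂ :=
  (-1) ^ (1 - (ζ : ℤ) - (r : ℤ)) *
    ((σ + υ - ζ - r).factorial : ℂ) / (((σ - ζ).factorial : ℂ) * ((υ - r).factorial : ℂ))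

end DoubleIntegratorNetwork

end

open DoubleIntegratorNetwork

/-!
The proof diagonalizes the network: with `L = R J R⁻¹`, the output is
`y(t) = C R H_J(t) R⁻¹ w₀`, where `H_J(t)` is block diagonal with blocks `H̃_k(t)`. The vector of
ones spans the kernel of the Laplacian (maximum principle) and is not in its range (minimum
principle), so the eigenvalue `0` is simple: the first block has size one and is annihilated by `C`,
and the other eigenvalues have positive real part (`JordanDecomposition.eig_succ_re_pos`). Expanding
`y* y` in the remaining Jordan coordinates gives the trace formula
(`JordanDecomposition.performance_eq_trace`), as soon as the scalar products with a nonzero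
coefficient converge.

This is the case because observable blocks are stable. In an observable block let `p` be the first
index with `C r_(k,p) ≠ 0`, in one row of `C`. Since `H̃_k` is upper triangular, the response of that
output to the coordinate `(k, p)` is a nonzero multiple of `h̃_pp`, the inverse Laplace transform of
`r(s) / ((s - ρ₁) (s - ρ₂))`. It is integrable, and neither root is `0`, so that `r(s) = s` cancels
no pole. Combining `h̃_pp` with a translate of itself isolates `e^{ρ₁ t}`, respectively `e^{ρ₂ t}`,
which is hence integrable (`re_neg_of_integrableOn_impulseResponse`).

For the closed forms, Laplace transforms are replaced by exponential generating functions: a function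
`f(t) = ∑ aₖ tᵏ / k!` is determined by the formal power series `∑ aₖ zᵏ`, which is `s 𝓛f(s)` at
`s = 1 / z`. For a Jordan block it is obtained by solving the resolvent equation in the ring of
formal power series (`velocitySeries_mul`). The coefficients `c_j` are those of the partial fraction
decomposition of `r(s) (γ_p + s γ_d)^(δ-1) / ((s - ρ₁) (s - ρ₂))^δ`, a polynomial identity that
follows from the Taylor expansions at `ρ₁` and `ρ₂` and a degree count
(`numerator_eq_polePart_add`, `numerator_eq_sum`). Reversing the polynomials, which is the
substitution `s = 1 / z`, turns it into a formula for `h̃_pq(t)` as a combination of functions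
`tʲ e^{ρ t} / j!` (`impulseResponse_jordanBlock_of_ne`, `impulseResponse_jordanBlock_of_eq`), whose
scalar products are elementary integrals (`hasPairing_expMonomial`).
-/

namespace DoubleIntegratorNetwork

open MeasureTheory Matrix

/-! ### Spectrum of the graph Laplacian -/

section Spectrum

variable {n : ℕ} {b : Matrix (Fin n) (Fin n) ℝ}

theorem laplacian_mulVec (hb : IsDigraphWeight b) {E : Type*} [CommRing E] [Algebra ℝ E]
    (v : Fin n → E) (i : Fin n) :
    ((laplacian b).map (algebraMap ℝ E) *ᵥ v) i =
      ∑ j, algebraMap ℝ E (b i j) * (v i - v j) := by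
  have h : ∀ j, (laplacian b).map (algebraMap ℝ E) i j * v j =
      (if i = j then (∑ j', algebraMap ℝ E (b i j')) * v i else 0) -
        algebraMap ℝ E (b i j) * v j := by
    intro j
    by_cases hij : i = j
    · subst hij
      simp [laplacian, hb.diag]
    · simp [laplacian, hij]
  simp only [mulVec, dotProduct, h, Finset.sum_sub_distrib, Finset.sum_ite_eq, Finset.mem_univ,
    if_true, mul_sub, Finset.sum_mul]

/-- A maximum of a function harmonic at every node spreads along the edges. -/
theorem eq_of_harmonic_of_reachable (hb : IsDigraphWeight b) {v : Fin n → ℝ}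
    (hv : ∀ i, ∑ j, b i j * (v i - v j) = 0) {i r : Fin n} (hi : ∀ j, v j ≤ v i)
    (h : Relation.ReflTransGen (fun i j => 0 < b i j) i r) : v r = v i := by
  induction h with
  | refl => rfl
  | @tail c d _ hcd ih =>
    have h0 := (Finset.sum_eq_zero_iff_of_nonneg (fun j _ => mul_nonneg (hb.nonneg c j)
      (sub_nonneg.2 (ih ▸ hi j)))).1 (hv c) d (Finset.mem_univ d)
    rcases mul_eq_zero.1 h0 with h0 | h0
    · exact absurd h0 hcd.ne'
    · linarith

theorem eq_of_harmonic (hb : IsDigraphWeight b) (hreach : HasGloballyReachableNode b)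
    {v : Fin n → ℝ} (hv : ∀ i, ∑ j, b i j * (v i - v j) = 0) (i j : Fin n) : v i = v j := by
  obtain ⟨r, hr⟩ := hreach
  obtain ⟨x, -, hx⟩ := Finset.exists_max_image Finset.univ v ⟨i, Finset.mem_univ i⟩
  obtain ⟨y, -, hy⟩ := Finset.exists_min_image Finset.univ v ⟨i, Finset.mem_univ i⟩
  have h1 := eq_of_harmonic_of_reachable hb hv (fun j => hx j (Finset.mem_univ j)) (hr x)
  have h2 := eq_of_harmonic_of_reachable hb (v := fun i => -v i)
    (fun i => by
      rw [← neg_eq_zero, ← Finset.sum_neg_distrib, ← hv i]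
      exact Finset.sum_congr rfl fun j _ => by ring)
    (fun j => neg_le_neg (hy j (Finset.mem_univ j))) (hr y)
  have := hx i (Finset.mem_univ i)
  have := hx j (Finset.mem_univ j)
  have := hy i (Finset.mem_univ i)
  have := hy j (Finset.mem_univ j)
  linarith

theorem laplacian_mulVec_complex (hb : IsDigraphWeight b) (v : Fin n → ℂ) (i : Fin n) :
    ((laplacian b).map (fun x : ℝ => (x : ℂ)) *ᵥ v) i = ∑ j, (b i j : ℂ) * (v i - v j) :=
  laplacian_mulVec hb v i

/-- The kernel of the Laplacian of a digraph with a globally reachable node consists of the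
constant vectors. -/
theorem eq_of_laplacian_mulVec_eq_zero (hb : IsDigraphWeight b)
    (hreach : HasGloballyReachableNode b) {v : Fin n → ℂ}
    (hv : (laplacian b).map (fun x : ℝ => (x : ℂ)) *ᵥ v = 0) (i j : Fin n) : v i = v j := by
  have h : ∀ i, ∑ j, (b i j : ℂ) * (v i - v j) = 0 := fun i => by
    rw [← laplacian_mulVec_complex hb, hv]; rfl
  apply Complex.ext
  · exact eq_of_harmonic hb hreach (v := fun i => (v i).re)
      (fun i => by simpa using congrArg Complex.re (h i)) i j
  · exact eq_of_harmonic hb hreach (v := fun i => (v i).im)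
      (fun i => by simpa using congrArg Complex.im (h i)) i j

/-- A nonzero constant vector is not in the range of the Laplacian: the real part of a suitable
multiple of a preimage would have no minimum. -/
theorem laplacian_mulVec_ne_const [NeZero n] (hb : IsDigraphWeight b) {c : ℂ} (hc : c ≠ 0)
    (u : Fin n → ℂ) : (laplacian b).map (fun x : ℝ => (x : ℂ)) *ᵥ u ≠ fun _ => c := by
  intro hu
  obtain ⟨y, -, hy⟩ := Finset.exists_min_image Finset.univ (fun i => (u i / c).re)
    ⟨0, Finset.mem_univ _⟩
  have h : ∑ j, (b y j : ℂ) * (u y / c - u j / c) = 1 := by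
    have := laplacian_mulVec_complex hb u y
    rw [congrFun hu y] at this
    calc ∑ j, (b y j : ℂ) * (u y / c - u j / c) = (∑ j, (b y j : ℂ) * (u y - u j)) / c := by
          rw [Finset.sum_div]
          exact Finset.sum_congr rfl fun j _ => by ring
      _ = 1 := by rw [← this, div_self hc]
  have h' : ∑ j, b y j * ((u y / c).re - (u j / c).re) = 1 := by
    simpa only [Complex.re_sum, Complex.re_ofReal_mul, Complex.sub_re, Complex.one_re] using
      congrArg Complex.re h
  have : ∑ j, b y j * ((u y / c).re - (u j / c).re) ≤ 0 :=
    Finset.sum_nonpos fun j _ => mul_nonpos_of_nonneg_of_nonpos (hb.nonneg y j)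
      (sub_nonpos.2 (hy j (Finset.mem_univ j)))
  linarith

/-- Nonzero eigenvalues of a Laplacian have positive real part, as in Gershgorin's circle
theorem: at an entry of maximal modulus of an eigenvector one gets `|d - a| ≤ d`, with `d` the
corresponding diagonal entry. -/
theorem re_pos_of_laplacian_mulVec_eq (hb : IsDigraphWeight b) {v : Fin n → ℂ} (hv : v ≠ 0)
    {a : ℂ} (ha : a ≠ 0)
    (h : (laplacian b).map (fun x : ℝ => (x : ℂ)) *ᵥ v = a • v) : 0 < a.re := by
  obtain ⟨i₀, hi₀⟩ := Function.ne_iff.1 hv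
  obtain ⟨i, -, hi⟩ := Finset.exists_max_image Finset.univ (fun i => ‖v i‖)
    ⟨i₀, Finset.mem_univ i₀⟩
  have hvi : 0 < ‖v i‖ := (norm_pos_iff.2 hi₀).trans_le (hi i₀ (Finset.mem_univ _))
  set d : ℝ := ∑ j, b i j with hd
  have h1 : ((d : ℂ) - a) * v i = ∑ j, (b i j : ℂ) * v j := by
    have := laplacian_mulVec_complex hb v i
    rw [h] at this
    simp only [Pi.smul_apply, smul_eq_mul, mul_sub, Finset.sum_sub_distrib,
      ← Finset.sum_mul] at this
    rw [hd, Complex.ofReal_sum, sub_mul, this]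
    ring
  have h2 : ‖(d : ℂ) - a‖ * ‖v i‖ ≤ d * ‖v i‖ := by
    rw [← norm_mul, h1, hd, Finset.sum_mul]
    refine (norm_sum_le _ _).trans (Finset.sum_le_sum fun j _ => ?_)
    rw [norm_mul, Complex.norm_real, Real.norm_of_nonneg (hb.nonneg i j)]
    exact mul_le_mul_of_nonneg_left (hi j (Finset.mem_univ j)) (hb.nonneg i j)
  have h3 : ‖(d : ℂ) - a‖ ≤ d := le_of_mul_le_mul_right h2 hvi
  have h4 : ‖(d : ℂ) - a‖ ^ 2 ≤ d ^ 2 := pow_le_pow_left₀ (norm_nonneg _) h3 2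
  have h5 : 0 < a.re ^ 2 + a.im ^ 2 := by
    have := Complex.normSq_pos.2 ha
    rw [Complex.normSq_apply] at this
    nlinarith
  have hd0 : 0 ≤ d := (norm_nonneg _).trans h3
  rw [Complex.sq_norm, Complex.normSq_apply] at h4
  simp only [Complex.sub_re, Complex.sub_im, Complex.ofReal_re, Complex.ofReal_im] at h4
  by_contra hcon
  nlinarith [mul_nonneg hd0 (sub_nonneg.2 (not_lt.1 hcon))]

end Spectrum

/-! ### The Jordan decomposition of the Laplacian -/

theorem jordanBlock_apply_zero {s : ℕ} (a : ℂ) (i : Fin s) (h : 0 < s) :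
    jordanBlock a s i ⟨0, h⟩ = if i = ⟨0, h⟩ then a else 0 := by
  simp [jordanBlock]

theorem jordanBlock_apply_succ {s : ℕ} (a : ℂ) (i : Fin s) (p : ℕ) (h : p + 1 < s) :
    jordanBlock a s i ⟨p + 1, h⟩ =
      (if i = ⟨p + 1, h⟩ then a else 0) + if i = ⟨p, by omega⟩ then 1 else 0 := by
  by_cases h1 : i = ⟨p + 1, h⟩
  · subst h1; simp [jordanBlock]
  · have h1' : ¬ i.val = p + 1 := fun h => h1 (Fin.ext h)
    simp [jordanBlock, h1', Fin.ext_iff]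

theorem jordanBlock_mul_apply {s : ℕ} (a : ℂ) {ι : Type*} (M : Matrix (Fin s) ι ℂ) (p : Fin s)
    (q : ι) : (jordanBlock a s * M) p q = a * M p q +
      if h : p.val + 1 < s then M ⟨p.val + 1, h⟩ q else 0 := by
  have h : ∀ j, jordanBlock a s p j * M j q =
      (if p = j then a * M p q else 0) + if p.val + 1 = j.val then M j q else 0 := by
    intro j
    by_cases h1 : p = j
    · subst h1; simp [jordanBlock]
    · by_cases h2 : p.val + 1 = j.val <;> simp [jordanBlock, h1, h2]
  rw [mul_apply]
  simp only [h, Finset.sum_add_distrib, Finset.sum_ite_eq, Finset.mem_univ, if_true]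
  congr 1
  split_ifs with hs
  · rw [Finset.sum_eq_single_of_mem ⟨p.val + 1, hs⟩ (Finset.mem_univ _)]
    · simp
    · intro j _ hj
      rw [if_neg]
      intro h
      exact hj (Fin.ext h.symm)
  · refine Finset.sum_eq_zero fun j _ => if_neg ?_
    intro h
    exact hs (h ▸ j.isLt)

namespace JordanDecomposition

section

variable {n m : ℕ} {L : Matrix (Fin n) (Fin n) ℝ} (D : JordanDecomposition L m)

/-- The Jordan matrix `J`. -/
def J : Matrix (Σ k, Fin (D.size k)) (Σ k, Fin (D.size k)) ℂ :=
  Matrix.blockDiagonal' fun k => jordanBlock (D.eig k) (D.size k)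

theorem map_mul_R : L.map (fun x : ℝ => (x : ℂ)) * D.R = D.R * D.J := by
  rw [D.decomp, Matrix.mul_assoc, D.Rinv_mul_R, Matrix.mul_one, J]

theorem mul_J_apply {ι : Type*} (M : Matrix ι (Σ k, Fin (D.size k)) ℂ) (i : ι)
    (k : Fin (m + 1)) (p : Fin (D.size k)) :
    (M * D.J) i ⟨k, p⟩ = ∑ p', M i ⟨k, p'⟩ * jordanBlock (D.eig k) (D.size k) p' p := by
  rw [mul_apply, Fintype.sum_sigma, Finset.sum_eq_single_of_mem k (Finset.mem_univ _)]
  · simp [J]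
  · intro j _ hj
    exact Finset.sum_eq_zero fun p' _ => by rw [J, blockDiagonal'_apply_ne _ _ _ hj, mul_zero]

theorem mulVec_col (k : Fin (m + 1)) (p : Fin (D.size k)) :
    L.map (fun x : ℝ => (x : ℂ)) *ᵥ (fun i => D.R i ⟨k, p⟩) =
      fun i => ∑ p', D.R i ⟨k, p'⟩ * jordanBlock (D.eig k) (D.size k) p' p := by
  ext i
  rw [← mul_J_apply, ← map_mul_R]
  rfl

theorem mulVec_col_zero (k : Fin (m + 1)) :
    L.map (fun x : ℝ => (x : ℂ)) *ᵥ (fun i => D.R i ⟨k, ⟨0, D.size_pos k⟩⟩) =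
      D.eig k • fun i => D.R i ⟨k, ⟨0, D.size_pos k⟩⟩ := by
  rw [mulVec_col]
  ext i
  simp [jordanBlock_apply_zero, mul_comm]

theorem mulVec_col_succ (k : Fin (m + 1)) (p : ℕ) (h : p + 1 < D.size k) :
    L.map (fun x : ℝ => (x : ℂ)) *ᵥ (fun i => D.R i ⟨k, ⟨p + 1, h⟩⟩) =
      fun i => D.eig k * D.R i ⟨k, ⟨p + 1, h⟩⟩ + D.R i ⟨k, ⟨p, by omega⟩⟩ := by
  rw [mulVec_col]
  ext i
  simp only [jordanBlock_apply_succ, mul_add, Finset.sum_add_distrib, mul_ite, mul_zero, mul_one,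
    Finset.sum_ite_eq', Finset.mem_univ, if_true]
  rw [mul_comm]

theorem sum_Rinv_mul_R (x y : Σ k, Fin (D.size k)) :
    ∑ i, D.Rinv x i * D.R i y = if x = y then 1 else 0 := by
  rw [← mul_apply, D.Rinv_mul_R, one_apply]

theorem col_ne_zero (x : Σ k, Fin (D.size k)) : (fun i => D.R i x) ≠ 0 := by
  intro h
  have := D.sum_Rinv_mul_R x x
  simp [fun i => congrFun h i] at this

end

section Laplacian

variable {n m : ℕ} [NeZero n] {b : Matrix (Fin n) (Fin n) ℝ}
  (D : JordanDecomposition (laplacian b) m)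

/-- An eigenvector of the Laplacian to the eigenvalue `0` in the decomposition is constant. -/
theorem exists_col_eq_const (hb : IsDigraphWeight b) (hreach : HasGloballyReachableNode b)
    (k : Fin (m + 1)) (hk : D.eig k = 0) :
    ∃ c : ℂ, c ≠ 0 ∧ ∀ i, D.R i ⟨k, ⟨0, D.size_pos k⟩⟩ = c := by
  have h0 := D.mulVec_col_zero k
  rw [hk, zero_smul] at h0
  have h := eq_of_laplacian_mulVec_eq_zero hb hreach h0
  refine ⟨D.R 0 ⟨k, ⟨0, D.size_pos k⟩⟩, fun hc => ?_, fun i => h i 0⟩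
  exact D.col_ne_zero ⟨k, ⟨0, D.size_pos k⟩⟩ (funext fun i => (h i 0).trans hc)

theorem size_zero (hb : IsDigraphWeight b) (hreach : HasGloballyReachableNode b) :
    D.size 0 = 1 := by
  by_contra hne
  have hlt : 0 + 1 < D.size 0 := by have := D.size_pos 0; omega
  obtain ⟨c, hc, h⟩ := D.exists_col_eq_const hb hreach 0 D.eig_zero
  apply laplacian_mulVec_ne_const hb hc (fun i => D.R i ⟨0, ⟨0 + 1, hlt⟩⟩)
  rw [D.mulVec_col_succ]
  ext i
  simp only [D.eig_zero, zero_mul, zero_add]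
  exact h i

/-- The eigenvalue `0` of the Laplacian is simple, and the other eigenvalues are in the open right
half-plane. -/
theorem eig_succ_re_pos (hb : IsDigraphWeight b) (hreach : HasGloballyReachableNode b)
    (k : Fin m) : 0 < (D.eig k.succ).re := by
  refine re_pos_of_laplacian_mulVec_eq hb (D.col_ne_zero ⟨k.succ, ⟨0, D.size_pos _⟩⟩) ?_
    (D.mulVec_col_zero k.succ)
  intro h0
  obtain ⟨c, hc, h⟩ := D.exists_col_eq_const hb hreach 0 D.eig_zero
  obtain ⟨c', hc', h'⟩ := D.exists_col_eq_const hb hreach k.succ h0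
  have h1 := D.sum_Rinv_mul_R ⟨0, ⟨0, D.size_pos _⟩⟩ ⟨0, ⟨0, D.size_pos _⟩⟩
  have h2 := D.sum_Rinv_mul_R ⟨0, ⟨0, D.size_pos _⟩⟩ ⟨k.succ, ⟨0, D.size_pos _⟩⟩
  rw [if_neg (fun h => (Fin.succ_ne_zero k) (congrArg Sigma.fst h).symm)] at h2
  simp only [h, h', ← Finset.sum_mul, if_true] at h1 h2
  rcases mul_eq_zero.1 h2 with h2 | h2
  · rw [h2, zero_mul] at h1
    exact zero_ne_one h1
  · exact hc' h2

/-- The first block has size one and is spanned by the vector of ones, so it is annihilated by an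
output matrix with zero row sums. -/
theorem map_mul_R_zero {q : ℕ} {C : Matrix (Fin q) (Fin n) ℝ} (hC : C *ᵥ 1 = 0)
    (hb : IsDigraphWeight b) (hreach : HasGloballyReachableNode b) (i : Fin q)
    (p : Fin (D.size 0)) : (C.map (fun x : ℝ => (x : ℂ)) * D.R) i ⟨0, p⟩ = 0 := by
  have hp : p = ⟨0, D.size_pos 0⟩ := by
    have := D.size_zero hb hreach
    ext; have := p.isLt; simp only; omega
  subst hp
  obtain ⟨c, -, h⟩ := D.exists_col_eq_const hb hreach 0 D.eig_zero
  have h1 : ∑ j, C i j = 0 := by simpa [mulVec, dotProduct] using congrFun hC i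
  simp only [mul_apply, h, map_apply, ← Finset.sum_mul]
  rw [← Complex.ofReal_sum, h1, Complex.ofReal_zero, zero_mul]

end Laplacian

end JordanDecomposition

/-! ### Markov parameters -/

section Markov

variable {𝕜 : Type*} [RCLike 𝕜] {ι κ : Type*} [Fintype ι] [DecidableEq ι] [Fintype κ]
  [DecidableEq κ]

/-- The derivatives at `0` of the impulse response function from `w` to `x`, by the recursion that
expresses `ẍ = -(k_p I + γ_p L) x - (k_d I + γ_d L) ẋ`. -/
def markov (g : Gains) (L : Matrix ι ι 𝕜) : ℕ → Matrix ι ι 𝕜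
  | 0 => 0
  | 1 => 1
  | k + 2 => -(g.kp • markov g L k + g.γp • (L * markov g L k)) -
      (g.kd • markov g L (k + 1) + g.γd • (L * markov g L (k + 1)))

/-- The order of differentiation that leads from the position to the output. -/
def OutputKind.order : OutputKind → ℕ
  | .position => 0
  | .velocity => 1

theorem stateMatrix_pow_mul_inputMatrix (g : Gains) (L : Matrix ι ι 𝕜) (k : ℕ) :
    stateMatrix g L ^ k * (inputMatrix : Matrix (ι ⊕ ι) ι 𝕜) =
      Matrix.fromRows (markov g L k) (markov g L (k + 1)) := by
  induction k with
  | zero => simp [inputMatrix, markov]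
  | succ k ih =>
    rw [pow_succ', Matrix.mul_assoc, ih, stateMatrix, fromBlocks_mul_fromRows]
    simp only [Matrix.zero_mul, Matrix.one_mul, zero_add, markov, Matrix.sub_mul, Matrix.neg_mul,
      Matrix.smul_mul]
    congr 1
    abel

theorem selectMatrix_mul_stateMatrix_pow_mul_inputMatrix (o : OutputKind) (g : Gains)
    (L : Matrix ι ι 𝕜) (k : ℕ) :
    (selectMatrix o : Matrix ι (ι ⊕ ι) 𝕜) * stateMatrix g L ^ k * (inputMatrix : Matrix (ι ⊕ ι) ι 𝕜) =
      markov g L (k + o.order) := by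
  rw [Matrix.mul_assoc, stateMatrix_pow_mul_inputMatrix]
  cases o <;> simp [selectMatrix, OutputKind.order, fromCols_mul_fromRows]

theorem hasSum_matrix_exp (A : Matrix ι ι 𝕜) :
    HasSum (fun k => ((k.factorial : ℝ)⁻¹) • A ^ k) (NormedSpace.exp A) := by
  open scoped Norms.Operator in
  have : CompleteSpace (Matrix ι ι 𝕜) := FiniteDimensional.complete 𝕜 _
  exact NormedSpace.exp_series_hasSum_exp' (𝕂 := ℝ) A

/-- The power series expansion of the impulse response function. -/
theorem hasSum_impulseResponse (o : OutputKind) (g : Gains) (L : Matrix ι ι 𝕜) (t : ℝ) :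
    HasSum (fun k => (t ^ k / (k.factorial : ℝ)) • markov g L (k + o.order))
      (impulseResponse o g L t) := by
  have h := (hasSum_matrix_exp (t • stateMatrix g L)).map
    ((Matrix.addMonoidHomMulRight (inputMatrix : Matrix (ι ⊕ ι) ι 𝕜)).comp
      (Matrix.addMonoidHomMulLeft (selectMatrix o : Matrix ι (ι ⊕ ι) 𝕜)))
    (by
      change Continuous fun M : Matrix (ι ⊕ ι) (ι ⊕ ι) 𝕜 =>
        (selectMatrix o : Matrix ι (ι ⊕ ι) 𝕜) * M * (inputMatrix : Matrix (ι ⊕ ι) ι 𝕜)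
      fun_prop)
  refine h.congr_fun fun k => ?_
  change _ = (selectMatrix o : Matrix ι (ι ⊕ ι) 𝕜) *
    ((k.factorial : ℝ)⁻¹ • (t • stateMatrix g L) ^ k) * (inputMatrix : Matrix (ι ⊕ ι) ι 𝕜)
  rw [smul_pow, smul_smul, Matrix.mul_smul, Matrix.smul_mul,
    selectMatrix_mul_stateMatrix_pow_mul_inputMatrix, mul_comm, ← div_eq_mul_inv]

theorem markov_mul_eq_mul_markov (g : Gains) {L : Matrix ι ι 𝕜} {J : Matrix κ κ 𝕜}
    {R : Matrix ι κ 𝕜} (h : L * R = R * J) (k : ℕ) : markov g L k * R = R * markov g J k := by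
  induction k using Nat.twoStepInduction with
  | zero => simp [markov]
  | one => simp [markov]
  | more k h1 h2 =>
    simp only [markov, Matrix.sub_mul, Matrix.neg_mul, Matrix.add_mul, Matrix.smul_mul,
      Matrix.mul_sub, Matrix.mul_neg, Matrix.mul_add, Matrix.mul_smul, Matrix.mul_assoc, h1, h2]
    simp only [← Matrix.mul_assoc, h]

theorem impulseResponse_mul_eq_mul_impulseResponse (o : OutputKind) (g : Gains)
    {L : Matrix ι ι 𝕜} {J : Matrix κ κ 𝕜} {R : Matrix ι κ 𝕜} (h : L * R = R * J) (t : ℝ) :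
    impulseResponse o g L t * R = R * impulseResponse o g J t := by
  have h1 := (hasSum_impulseResponse o g L t).map (Matrix.addMonoidHomMulRight R)
    (by change Continuous fun M : Matrix ι ι 𝕜 => M * R; fun_prop)
  have h2 := (hasSum_impulseResponse o g J t).map (Matrix.addMonoidHomMulLeft R)
    (by change Continuous fun M : Matrix κ κ 𝕜 => R * M; fun_prop)
  refine h1.unique (h2.congr_fun fun k => ?_)
  change ((t ^ k / (k.factorial : ℝ)) • markov g L (k + o.order)) * R =
    R * ((t ^ k / (k.factorial : ℝ)) • markov g J (k + o.order))
  rw [Matrix.mul_smul, Matrix.smul_mul, markov_mul_eq_mul_markov g h]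

theorem markov_blockDiagonal' (g : Gains) {N : κ → Type*} [∀ i, Fintype (N i)]
    [∀ i, DecidableEq (N i)] (J : ∀ i, Matrix (N i) (N i) 𝕜) (k : ℕ) :
    markov g (blockDiagonal' J) k = blockDiagonal' fun i => markov g (J i) k := by
  induction k using Nat.twoStepInduction with
  | zero => exact blockDiagonal'_zero.symm
  | one => exact blockDiagonal'_one.symm
  | more k h1 h2 =>
    simp only [markov, h1, h2, ← blockDiagonal'_mul, ← blockDiagonal'_smul, ← blockDiagonal'_add,
      ← blockDiagonal'_neg, ← blockDiagonal'_sub]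
    rfl

theorem impulseResponse_blockDiagonal' (o : OutputKind) (g : Gains) {N : κ → Type*}
    [∀ i, Fintype (N i)] [∀ i, DecidableEq (N i)] (J : ∀ i, Matrix (N i) (N i) 𝕜) (t : ℝ) :
    impulseResponse o g (blockDiagonal' J) t =
      blockDiagonal' fun i => impulseResponse o g (J i) t := by
  have h1 := hasSum_impulseResponse o g (blockDiagonal' J) t
  have h2 : HasSum (fun k i => (t ^ k / (k.factorial : ℝ)) • markov g (J i) (k + o.order))
      (fun i => impulseResponse o g (J i) t) :=
    Pi.hasSum.2 fun i => hasSum_impulseResponse o g (J i) t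
  refine h1.unique (h2.matrix_blockDiagonal'.congr_fun fun k => ?_)
  rw [markov_blockDiagonal', ← blockDiagonal'_smul]
  rfl

theorem markov_map_ofReal (g : Gains) (L : Matrix ι ι ℝ) (k : ℕ) :
    markov g (L.map (fun x : ℝ => (x : ℂ))) k = (markov g L k).map (fun x : ℝ => (x : ℂ)) := by
  induction k using Nat.twoStepInduction with
  | zero => ext; simp [markov]
  | one => ext i j; by_cases h : i = j <;> simp [markov, one_apply, h]
  | more k h1 h2 =>
    have h (N : Matrix ι ι ℝ) : L.map (fun x : ℝ => (x : ℂ)) * N.map (fun x : ℝ => (x : ℂ)) =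
        (L * N).map (fun x : ℝ => (x : ℂ)) := (Matrix.map_mul (f := Complex.ofRealHom)).symm
    simp only [markov, h1, h2, h]
    ext i j
    simp

theorem impulseResponse_map_ofReal (o : OutputKind) (g : Gains) (L : Matrix ι ι ℝ) (t : ℝ) :
    impulseResponse o g (L.map (fun x : ℝ => (x : ℂ))) t =
      (impulseResponse o g L t).map (fun x : ℝ => (x : ℂ)) := by
  have h1 := hasSum_impulseResponse o g (L.map (fun x : ℝ => (x : ℂ))) t
  have h2 := (hasSum_impulseResponse o g L t).map Complex.ofRealHom.toAddMonoidHom.mapMatrix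
    (by
      change Continuous fun M : Matrix ι ι ℝ => M.map (fun x : ℝ => (x : ℂ))
      exact continuous_id.matrix_map Complex.continuous_ofReal)
  refine h1.unique (h2.congr_fun fun k => ?_)
  rw [markov_map_ofReal]
  ext i j
  simp

end Markov

/-! ### Exponential generating functions and exponential polynomials -/

section GeneratingFunction

open PowerSeries

/-- `f(t) = ∑ aₖ tᵏ / k!` for the coefficients `aₖ` of the power series `F`. In terms of the Laplace
transform, `F(z) = s 𝓛f(s)` with `s = 1 / z`. -/
def IsEGF (F : ℂ⟦X⟧) (f : ℝ → ℂ) : Prop :=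
  ∀ t : ℝ, HasSum (fun k => (t ^ k / (k.factorial : ℝ)) • coeff k F) (f t)

theorem IsEGF.unique {F : ℂ⟦X⟧} {f f' : ℝ → ℂ} (h : IsEGF F f) (h' : IsEGF F f') : f = f' :=
  funext fun t => (h t).unique (h' t)

theorem IsEGF.add {F G : ℂ⟦X⟧} {f f' : ℝ → ℂ} (h : IsEGF F f) (h' : IsEGF G f') :
    IsEGF (F + G) fun t => f t + f' t := fun t =>
  ((h t).add (h' t)).congr_fun fun k => by rw [map_add, smul_add]

theorem IsEGF.C_mul {F : ℂ⟦X⟧} {f : ℝ → ℂ} (c : ℂ) (h : IsEGF F f) :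
    IsEGF (C c * F) fun t => c * f t := fun t =>
  ((h t).mul_left c).congr_fun fun k => by rw [coeff_C_mul, mul_smul_comm]

theorem IsEGF.sum {α : Type*} (s : Finset α) {F : α → ℂ⟦X⟧} {f : α → ℝ → ℂ}
    (h : ∀ a ∈ s, IsEGF (F a) (f a)) : IsEGF (∑ a ∈ s, F a) fun t => ∑ a ∈ s, f a t := fun t =>
  (hasSum_sum fun a ha => h a ha t).congr_fun fun k => by rw [map_sum, Finset.smul_sum]

/-- The inverse Laplace transform `tʲ e^{ρt} / j!` of `(s - ρ)^(-(j+1))`. -/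
noncomputable def expMonomial (ρ : ℂ) (j : ℕ) (t : ℝ) : ℂ :=
  (t : ℂ) ^ j / (j.factorial : ℂ) * Complex.exp (ρ * t)

/-- The power series of `(1 - ρ z)^(-(j+1))`. -/
noncomputable def geomPow (ρ : ℂ) (j : ℕ) : ℂ⟦X⟧ :=
  rescale ρ (PowerSeries.mk fun k => ((j + k).choose j : ℂ))

theorem coeff_geomPow (ρ : ℂ) (j k : ℕ) :
    coeff k (geomPow ρ j) = ρ ^ k * ((j + k).choose j : ℂ) := by
  rw [geomPow, coeff_rescale, coeff_mk]

theorem geomPow_mul_pow (ρ : ℂ) (j : ℕ) : geomPow ρ j * (1 - C ρ * X) ^ (j + 1) = 1 := by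
  have h := congrArg (rescale ρ) (mk_add_choose_mul_one_sub_pow_eq_one ℂ j)
  rwa [map_mul, map_pow, map_sub, map_one, rescale_X] at h

theorem isEGF_expMonomial (ρ : ℂ) (j : ℕ) : IsEGF (X ^ j * geomPow ρ j) (expMonomial ρ j) := by
  intro t
  have h := (NormedSpace.expSeries_div_hasSum_exp (ρ * (t : ℂ))).mul_left
    ((t : ℂ) ^ j / (j.factorial : ℂ))
  rw [← Complex.exp_eq_exp_ℂ] at h
  refine (hasSum_nat_add_iff' j).1 ?_
  rw [Finset.sum_eq_zero, sub_zero]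
  · refine h.congr_fun fun k => ?_
    rw [add_comm k j, coeff_X_pow_mul', if_pos (by omega), Nat.add_sub_cancel_left, coeff_geomPow,
      Complex.real_smul, Nat.cast_add_choose]
    have h1 : ((j + k).factorial : ℂ) ≠ 0 := by exact_mod_cast (Nat.factorial_pos _).ne'
    have h2 : (j.factorial : ℂ) ≠ 0 := by exact_mod_cast (Nat.factorial_pos _).ne'
    have h3 : (k.factorial : ℂ) ≠ 0 := by exact_mod_cast (Nat.factorial_pos _).ne'
    push_cast
    field_simp
    ring
  · intro k hk
    rw [coeff_X_pow_mul', if_neg (by simpa using hk), smul_zero]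

end GeneratingFunction

/-! ### The response of a Jordan block -/

section JordanResponse

open PowerSeries

/-- `z² (γ_p + s γ_d)` for `z = 1 / s`. -/
noncomputable def gainSeries (g : Gains) : ℂ⟦X⟧ := C (g.γd : ℂ) * X + C (g.γp : ℂ) * X ^ 2

/-- The generating function of the derivatives of the velocity response of a Jordan block. -/
noncomputable def velocitySeries (g : Gains) (a : ℂ) (s : ℕ) (p q : Fin s) : ℂ⟦X⟧ :=
  PowerSeries.mk fun k => markov g (jordanBlock a s) (k + 1) p q

theorem X_mul_velocitySeries (g : Gains) (a : ℂ) (s : ℕ) (p q : Fin s) :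
    X * velocitySeries g a s p q = PowerSeries.mk fun k => markov g (jordanBlock a s) k p q := by
  ext k
  cases k with
  | zero => simp [markov]
  | succ k => rw [coeff_succ_X_mul, velocitySeries, coeff_mk, coeff_mk]

/-- The resolvent equation of a Jordan block. -/
theorem velocitySeries_eq (g : Gains) (a : ℂ) (s : ℕ) (p q : Fin s) :
    (1 + C (g.kd + g.γd * a) * X + C (g.kp + g.γp * a) * X ^ 2) * velocitySeries g a s p q =
      (if p = q then 1 else 0) -
        gainSeries g * if h : p.val + 1 < s then velocitySeries g a s ⟨p.val + 1, h⟩ q else 0 := by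
  have key : velocitySeries g a s p q = (if p = q then 1 else 0) -
      X * (C (g.kp + g.γp * a) * (X * velocitySeries g a s p q) +
        C (g.kd + g.γd * a) * velocitySeries g a s p q +
        C (g.γp : ℂ) * (if h : p.val + 1 < s then
          X * velocitySeries g a s ⟨p.val + 1, h⟩ q else 0) +
        C (g.γd : ℂ) * (if h : p.val + 1 < s then
          velocitySeries g a s ⟨p.val + 1, h⟩ q else 0)) := by
    ext k
    cases k with
    | zero =>
      by_cases h : p = q <;> simp [velocitySeries, markov, one_apply, h]
    | succ k =>
      rw [map_sub, coeff_succ_X_mul]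
      simp only [X_mul_velocitySeries]
      have h1 : coeff (k + 1) (if p = q then (1 : ℂ⟦X⟧) else 0) = 0 := by
        split_ifs <;> simp [coeff_one]
      rw [h1]
      rw [map_add (coeff k), map_add (coeff k), map_add (coeff k)]
      simp only [coeff_C_mul, velocitySeries, coeff_mk, markov, Matrix.sub_apply, Matrix.neg_apply,
        Matrix.add_apply, Matrix.smul_apply, jordanBlock_mul_apply, Complex.real_smul]
      split_ifs with h
      · simp only [coeff_mk]
        ring
      · simp only [map_zero]
        ring
  have : (1 + C (g.kd + g.γd * a) * X + C (g.kp + g.γp * a) * X ^ 2) * velocitySeries g a s p q =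
    velocitySeries g a s p q + X * (C (g.kp + g.γp * a) * (X * velocitySeries g a s p q) +
        C (g.kd + g.γd * a) * velocitySeries g a s p q) := by ring
  rw [this]
  nth_rewrite 1 [key]
  rw [gainSeries]
  split_ifs <;> ring

theorem AreRoots.sum_eq {g : Gains} {a ρ₁ ρ₂ : ℂ} (h : AreRoots g a ρ₁ ρ₂) :
    g.kd + g.γd * a = -(ρ₁ + ρ₂) := by
  linear_combination h 1 - h 0

theorem AreRoots.prod_eq {g : Gains} {a ρ₁ ρ₂ : ℂ} (h : AreRoots g a ρ₁ ρ₂) :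
    g.kp + g.γp * a = ρ₁ * ρ₂ := by
  linear_combination h 0

theorem constantCoeff_denominator_ne_zero (c₁ c₂ : ℂ) :
    (1 + C c₁ * X + C c₂ * X ^ 2 : ℂ⟦X⟧) ≠ 0 := by
  intro h
  simpa using congrArg constantCoeff h

/-- Below the diagonal the velocity response vanishes. The induction runs upwards from the last row;
`d` is the number of rows below `p`. -/
theorem velocitySeries_of_lt (g : Gains) (a : ℂ) {s : ℕ} {q : Fin s} (d : ℕ) :
    ∀ p : Fin s, p.val + d + 1 = s → q < p → velocitySeries g a s p q = 0 := by
  induction d with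
  | zero =>
    intro p hp hpq
    have h := velocitySeries_eq g a s p q
    rw [if_neg hpq.ne', dif_neg (by omega), mul_zero, sub_zero] at h
    exact (mul_eq_zero.1 h).resolve_left (constantCoeff_denominator_ne_zero _ _)
  | succ d ih =>
    intro p hp hpq
    have h := velocitySeries_eq g a s p q
    have hlt : q.val < p.val := hpq
    rw [if_neg hpq.ne', dif_pos (by omega), ih ⟨p.val + 1, by omega⟩ (by simp only; omega)
      (Fin.lt_def.2 (by simp only; omega)), mul_zero, sub_zero] at h
    exact (mul_eq_zero.1 h).resolve_left (constantCoeff_denominator_ne_zero _ _)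

/-- The transfer function `(-1)ᵈ s (γ_p + s γ_d)ᵈ / ((s - ρ₁) (s - ρ₂))^(d+1)`, `d = q - p`, from the
input `q` to the velocity `p` of a Jordan block, written in the variable `z = 1 / s`. -/
theorem velocitySeries_mul {g : Gains} {a ρ₁ ρ₂ : ℂ} (hρ : AreRoots g a ρ₁ ρ₂) {s : ℕ} (q : Fin s)
    (d : ℕ) : ∀ p : Fin s, p.val + d = q.val →
      ((1 - C ρ₁ * X) * (1 - C ρ₂ * X)) ^ (d + 1) * velocitySeries g a s p q =
        (-1) ^ d * gainSeries g ^ d := by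
  have hχ : (1 + C (g.kd + g.γd * a) * X + C (g.kp + g.γp * a) * X ^ 2 : ℂ⟦X⟧) =
      (1 - C ρ₁ * X) * (1 - C ρ₂ * X) := by
    rw [hρ.sum_eq, hρ.prod_eq, map_neg, map_add, map_mul]
    ring
  induction d with
  | zero =>
    intro p hp
    have h := velocitySeries_eq g a s p q
    have h0 : (if h : p.val + 1 < s then velocitySeries g a s ⟨p.val + 1, h⟩ q else 0) = 0 := by
      split_ifs with hs
      · exact velocitySeries_of_lt g a (s - 1 - (p.val + 1)) _ (by simp only; omega)
          (Fin.lt_def.2 (by simp only; omega))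
      · rfl
    rw [h0, mul_zero, sub_zero, if_pos (Fin.ext (by omega)), hχ] at h
    simpa using h
  | succ d ih =>
    intro p hp
    have h := velocitySeries_eq g a s p q
    have hs : p.val + 1 < s := by omega
    rw [dif_pos hs, if_neg (fun h => by subst h; omega), hχ, zero_sub] at h
    rw [pow_succ, mul_assoc, h, mul_neg, mul_left_comm, ih _ (by simp only; omega)]
    ring

/-- Below the diagonal the response of a Jordan block vanishes. -/
theorem impulseResponse_jordanBlock_of_lt (o : OutputKind) (g : Gains) (a : ℂ) {s : ℕ}
    {p q : Fin s} (hpq : q < p) (t : ℝ) : impulseResponse o g (jordanBlock a s) t p q = 0 := by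
  have h0 := velocitySeries_of_lt g a (s - 1 - p.val) p (by omega) hpq
  have h1 : ∀ k, markov g (jordanBlock a s) k p q = 0 := by
    intro k
    have h := congrArg (coeff k) (X_mul_velocitySeries g a s p q)
    rwa [h0, mul_zero, map_zero, coeff_mk, eq_comm] at h
  have h2 := Pi.hasSum.1 (Pi.hasSum.1 (hasSum_impulseResponse o g (jordanBlock a s) t) p) q
  refine h2.unique (hasSum_zero.congr_fun fun k => ?_)
  rw [Matrix.smul_apply, h1, smul_zero]

/-- The power of `z = 1 / s` by which the transfer function to the output differs from the one to
the velocity. -/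
def OutputKind.lag : OutputKind → ℕ
  | .position => 1
  | .velocity => 0

theorem isEGF_impulseResponse (o : OutputKind) (g : Gains) (a : ℂ) {s : ℕ} (p q : Fin s) :
    IsEGF (X ^ o.lag * velocitySeries g a s p q)
      fun t => impulseResponse o g (jordanBlock a s) t p q := by
  intro t
  have h2 := Pi.hasSum.1 (Pi.hasSum.1 (hasSum_impulseResponse o g (jordanBlock a s) t) p) q
  refine h2.congr_fun fun k => ?_
  cases o
  · rw [OutputKind.lag, pow_one, X_mul_velocitySeries, coeff_mk]
    rfl
  · rw [OutputKind.lag, pow_zero, one_mul, velocitySeries, coeff_mk]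
    rfl

end JordanResponse

/-! ### Partial fractions -/

section PartialFractions

open Polynomial

/-- The numerator `r(s) (γ_p + s γ_d)^(δ-1)` of the transfer functions of a Jordan block. -/
noncomputable def numerator (o : OutputKind) (g : Gains) (δ : ℕ) : ℂ[X] :=
  (match o with
    | .position => 1
    | .velocity => X) * (C (g.γp : ℂ) + C (g.γd : ℂ) * X) ^ (δ - 1)

theorem coeff_C_add_C_mul_X_pow (c d : ℂ) (k n : ℕ) :
    ((C c + C d * X) ^ k).coeff n = d ^ n * (k.choose n : ℂ) * c ^ (k - n) := by
  have h : (C c + C d * X : ℂ[X]) ^ k = ∑ i ∈ Finset.range (k + 1),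
      C (d ^ i * (k.choose i : ℂ) * c ^ (k - i)) * X ^ i := by
    rw [add_comm, add_pow]
    refine Finset.sum_congr rfl fun i _ => ?_
    rw [mul_pow, ← C_pow, ← C_pow, ← C_eq_natCast, C_mul, C_mul]
    ring
  rw [h, finsetSum_coeff]
  simp only [coeff_C_mul, coeff_X_pow, mul_ite, mul_one, mul_zero, Finset.sum_ite_eq,
    Finset.mem_range]
  split_ifs with hn
  · rfl
  · rw [Nat.choose_eq_zero_of_lt (by omega)]
    simp

/-- The coefficients for a repeated root are the Taylor coefficients of the numerator. -/
theorem coeff_numerator_comp (o : OutputKind) (g : Gains) {δ : ℕ} (hδ : 0 < δ) (ρ : ℂ) (n : ℕ) :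
    ((numerator o g δ).comp (X + C ρ)).coeff n = coeffRepeated o g δ ρ (n + 1) := by
  obtain ⟨m, rfl⟩ : ∃ m, δ = m + 1 := ⟨δ - 1, by omega⟩
  have hψ : (C (g.γp : ℂ) + C (g.γd : ℂ) * (X + C ρ)) =
      C ((g.γp : ℂ) + ρ * g.γd) + C (g.γd : ℂ) * X := by
    rw [C_add, C_mul]; ring
  cases o with
  | position =>
    simp only [numerator, coeffRepeated, gainFactor, one_mul, pow_comp, add_comp, mul_comp, C_comp,
      X_comp, hψ, coeff_C_add_C_mul_X_pow, Nat.add_sub_cancel, Nat.add_le_add_iff_right,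
      Nat.add_sub_add_right]
    split_ifs with h
    · rfl
    · rw [Nat.choose_eq_zero_of_lt (by omega)]
      simp
  | velocity =>
    simp only [numerator, coeffRepeated, gainFactor, mul_comp, pow_comp, add_comp, C_comp,
      X_comp, hψ, Nat.add_sub_cancel, Nat.add_le_add_iff_right, Nat.add_sub_add_right,
      add_mul X, coeff_add, coeff_C_mul, coeff_C_add_C_mul_X_pow]
    cases n with
    | zero =>
      have h : ((m + 1 : ℕ) : ℂ) ≠ 0 := Nat.cast_ne_zero.2 (by omega)
      rw [coeff_X_mul_zero]
      simp only [Nat.zero_le, if_true, pow_zero, Nat.choose_zero_right,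
        Nat.cast_zero, Nat.cast_one, zero_mul, zero_add, one_mul, mul_one, sub_zero, Nat.sub_zero]
      rw [mul_comm _ ρ, mul_div_assoc, div_self h, mul_one]
    | succ n =>
      rw [coeff_X_mul, coeff_C_add_C_mul_X_pow]
      rcases lt_trichotomy (n + 1) (m + 1) with h | h | h
      · have h1 : ((m + 1 : ℕ) : ℂ) - ((n + 1 : ℕ) : ℂ) ≠ 0 := by
          rw [sub_ne_zero]
          exact_mod_cast h.ne'
        -- relates the two consecutive coefficients that the factor `s = ρ + (s - ρ)` combines
        have h2 : (m.choose (n + 1) : ℂ) * (n + 1) = m.choose n * ((m : ℂ) - n) := by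
          have := Nat.choose_succ_right_eq m n
          rw [← Nat.cast_sub (by omega)]
          exact_mod_cast this
        obtain ⟨k, rfl⟩ : ∃ k, m = n + 1 + k := ⟨m - (n + 1), by omega⟩
        rw [if_pos (by omega), Nat.add_sub_cancel_left,
          show n + 1 + k - n = k + 1 by omega, div_mul_eq_mul_div, div_mul_eq_mul_div,
          eq_div_iff h1]
        push_cast at h2 ⊢
        linear_combination (-(g.γd : ℂ) ^ n * (g.γp + ρ * g.γd) ^ (k + 1)) * h2
      · obtain rfl : m = n := by omega
        simp
      · rw [if_neg (by omega), if_neg (by omega), Nat.choose_eq_zero_of_lt (by omega),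
          Nat.choose_eq_zero_of_lt (by omega)]
        simp

theorem natDegree_numerator_le (o : OutputKind) (g : Gains) {δ : ℕ} (hδ : 0 < δ) :
    (numerator o g δ).natDegree ≤ δ := by
  have h : ((C (g.γp : ℂ) + C (g.γd : ℂ) * X) ^ (δ - 1)).natDegree ≤ δ - 1 := by
    have h1 : (C (g.γp : ℂ) + C (g.γd : ℂ) * X).natDegree ≤ 1 := by compute_degree
    simpa using natDegree_pow_le_of_le (δ - 1) h1
  cases o with
  | position =>
    simp only [numerator, one_mul]
    omega
  | velocity =>
    have := natDegree_mul_le_of_le (natDegree_X_le (R := ℂ)) h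
    simp only [numerator]
    omega

/-- The Taylor coefficient of order `n` at `ρ` of the numerator divided by `(s - ρ')^δ`. -/
theorem distinctHalf_succ (o : OutputKind) (g : Gains) {δ : ℕ} {ρ ρ' : ℂ} (h : ρ ≠ ρ') {n : ℕ}
    (hn : n < δ) : distinctHalf o g δ ρ ρ' (n + 1) =
      PowerSeries.coeff n (((numerator o g δ).comp (X + C ρ) : ℂ[X]) *
        (PowerSeries.C ((ρ - ρ') ^ δ)⁻¹ * geomPow (-(ρ - ρ')⁻¹) (δ - 1)) : PowerSeries ℂ) := by
  have hd : ρ - ρ' ≠ 0 := sub_ne_zero.2 h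
  rw [PowerSeries.coeff_mul, Finset.Nat.sum_antidiagonal_eq_sum_range_succ_mk, distinctHalf]
  refine Finset.sum_congr rfl fun ζ hζ => ?_
  rw [Finset.mem_range] at hζ
  rw [Polynomial.coeff_coe, coeff_numerator_comp o g (by omega), PowerSeries.coeff_C_mul,
    coeff_geomPow, coeffRepeated.eq_def, if_pos (by omega), tau]
  obtain ⟨j, rfl⟩ : ∃ j, n = ζ + j := ⟨n - ζ, by omega⟩
  obtain ⟨m, rfl⟩ : ∃ m, δ = m + 1 := ⟨δ - 1, by omega⟩
  have hch := Nat.choose_mul (n := m + j) (k := ζ + j) (s := j) (by omega)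
  rw [Nat.add_sub_cancel, Nat.add_sub_cancel, ← Nat.choose_symm_add (a := ζ),
    ← Nat.choose_symm_add (a := m)] at hch
  have hch' : (((ζ + j).choose ζ : ℕ) : ℂ) * ((m + j).choose (ζ + j) : ℕ) =
      (m.choose ζ : ℕ) * ((m + j).choose m : ℕ) := by
    rw [← Nat.cast_mul, ← Nat.cast_mul, mul_comm, hch, mul_comm]
  dsimp only
  rw [show ζ + j + 1 - ζ - 1 = j by omega, show ζ + j + 1 - 1 = ζ + j by omega,
    show m + 1 + (ζ + j + 1) - ζ - 2 = m + j by omega, show m + 1 - ζ - 1 = m - ζ by omega,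
    show m + 1 + (ζ + j + 1) - ζ - 1 = m + 1 + j by omega, show ζ + j - ζ = j by omega,
    show m + 1 - 1 = m by omega, show ζ + 1 - 1 = ζ by omega,
    show m + 1 - (ζ + 1) = m - ζ by omega, neg_pow (ρ - ρ')⁻¹, inv_pow,
    pow_add (ρ - ρ')]
  field_simp
  linear_combination (gainFactor o g (m + 1) ρ ζ * (g.γp + ρ * g.γd) ^ (m - ζ)) * hch'

/-- The part `∑ cₙ₊₁ (s - ρ)ⁿ (s - ρ')^δ` of the numerator that belongs to the poles at `ρ`. -/
noncomputable def polePart (o : OutputKind) (g : Gains) (δ : ℕ) (ρ ρ' : ℂ) : ℂ[X] :=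
  ∑ n ∈ Finset.range δ, C (distinctHalf o g δ ρ ρ' (n + 1)) * (X - C ρ) ^ n * (X - C ρ') ^ δ

theorem pow_dvd_polePart_sub (o : OutputKind) (g : Gains) {δ : ℕ} (hδ : 0 < δ) {ρ ρ' : ℂ}
    (h : ρ ≠ ρ') : (X - C ρ) ^ δ ∣ polePart o g δ ρ ρ' - numerator o g δ := by
  have hd : ρ - ρ' ≠ 0 := sub_ne_zero.2 h
  set Q : ℂ[X] := ∑ n ∈ Finset.range δ, C (distinctHalf o g δ ρ ρ' (n + 1)) * X ^ n with hQ
  set P : ℂ[X] := (numerator o g δ).comp (X + C ρ) with hP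
  set S : PowerSeries ℂ :=
    PowerSeries.C ((ρ - ρ') ^ δ)⁻¹ * geomPow (-(ρ - ρ')⁻¹) (δ - 1) with hS
  have hS1 : S * (PowerSeries.C (ρ - ρ') + PowerSeries.X) ^ δ = 1 := by
    have h1 := geomPow_mul_pow (-(ρ - ρ')⁻¹) (δ - 1)
    rw [Nat.sub_add_cancel hδ] at h1
    have h2 : (PowerSeries.C (ρ - ρ') + PowerSeries.X : PowerSeries ℂ) = PowerSeries.C (ρ - ρ') *
        (1 - PowerSeries.C (-(ρ - ρ')⁻¹) * PowerSeries.X) := by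
      rw [mul_sub, ← mul_assoc, ← map_mul, mul_neg, mul_inv_cancel₀ hd, map_neg, map_one]
      ring
    rw [hS, h2, mul_pow, mul_mul_mul_comm, h1, mul_one, ← map_pow, ← map_mul,
      inv_mul_cancel₀ (pow_ne_zero _ hd), map_one]
  have h1 : PowerSeries.X ^ δ ∣ (Q : PowerSeries ℂ) - (P : PowerSeries ℂ) * S := by
    rw [PowerSeries.X_pow_dvd_iff]
    intro n hn
    rw [map_sub, ← distinctHalf_succ o g h hn, Polynomial.coeff_coe, hQ, finsetSum_coeff]
    simp [coeff_X_pow, hn]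
  have h2 : X ^ δ ∣ Q * (C (ρ - ρ') + X) ^ δ - P := by
    rw [Polynomial.X_pow_dvd_iff]
    have h3 : PowerSeries.X ^ δ ∣ ((Q * (C (ρ - ρ') + X) ^ δ - P : ℂ[X]) : PowerSeries ℂ) := by
      have h4 := h1.mul_right ((PowerSeries.C (ρ - ρ') + PowerSeries.X) ^ δ)
      rw [sub_mul, mul_assoc, hS1, mul_one] at h4
      simpa using h4
    intro n hn
    rw [← Polynomial.coeff_coe]
    exact PowerSeries.X_pow_dvd_iff.1 h3 n hn
  have h5 := map_dvd (compRingHom (X - C ρ)) h2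
  simp only [map_pow, map_sub, map_mul, map_add, coe_compRingHom_apply, X_comp, C_comp] at h5
  have h6 : P.comp (X - C ρ) = numerator o g δ := by
    rw [hP, comp_assoc]
    simp
  have h7 : Q.comp (X - C ρ) * (C ρ - C ρ' + (X - C ρ)) ^ δ = polePart o g δ ρ ρ' := by
    rw [polePart, hQ, sum_comp, Finset.sum_mul]
    refine Finset.sum_congr rfl fun n _ => ?_
    rw [show C ρ - C ρ' + (X - C ρ) = X - C ρ' by ring]
    simp
  rwa [h6, h7] at h5

theorem natDegree_polePart_lt (o : OutputKind) (g : Gains) {δ : ℕ} (hδ : 0 < δ) (ρ ρ' : ℂ) :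
    (polePart o g δ ρ ρ').natDegree < 2 * δ := by
  refine lt_of_le_of_lt (natDegree_sum_le_of_forall_le (n := 2 * δ - 1) _ _ fun n hn => ?_)
    (by omega)
  rw [Finset.mem_range] at hn
  have h1 : (C (distinctHalf o g δ ρ ρ' (n + 1)) * (X - C ρ) ^ n * (X - C ρ') ^ δ).natDegree ≤
      0 + n * 1 + δ * 1 :=
    natDegree_mul_le_of_le (natDegree_mul_le_of_le (natDegree_C _).le
      (natDegree_pow_le_of_le n (natDegree_X_sub_C_le ρ)))
      (natDegree_pow_le_of_le δ (natDegree_X_sub_C_le ρ'))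
  omega

/-- The partial fraction decomposition for distinct roots. -/
theorem numerator_eq_polePart_add (o : OutputKind) (g : Gains) {δ : ℕ} (hδ : 0 < δ) {ρ ρ' : ℂ}
    (h : ρ ≠ ρ') : numerator o g δ = polePart o g δ ρ ρ' + polePart o g δ ρ' ρ := by
  have hdvd (ρ ρ' : ℂ) : (X - C ρ') ^ δ ∣ polePart o g δ ρ ρ' :=
    Finset.dvd_sum fun n _ => Dvd.intro_left _ rfl
  have h1 : (X - C ρ) ^ δ ∣
      polePart o g δ ρ ρ' + polePart o g δ ρ' ρ - numerator o g δ := by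
    have := (pow_dvd_polePart_sub o g hδ h).add (hdvd ρ' ρ)
    rwa [sub_add_eq_add_sub] at this
  have h2 : (X - C ρ') ^ δ ∣
      polePart o g δ ρ ρ' + polePart o g δ ρ' ρ - numerator o g δ := by
    have := (pow_dvd_polePart_sub o g hδ h.symm).add (hdvd ρ ρ')
    rwa [sub_add_eq_add_sub, add_comm] at this
  have h3 := (isCoprime_X_sub_C_of_isUnit_sub (sub_ne_zero.2 h).isUnit).pow (m := δ) (n := δ)
    |>.mul_dvd h1 h2
  have h4 : polePart o g δ ρ ρ' + polePart o g δ ρ' ρ - numerator o g δ = 0 := by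
    refine eq_zero_of_dvd_of_natDegree_lt h3 ?_
    rw [natDegree_mul (pow_ne_zero _ (X_sub_C_ne_zero _)) (pow_ne_zero _ (X_sub_C_ne_zero _)),
      natDegree_pow, natDegree_pow, natDegree_X_sub_C, natDegree_X_sub_C]
    have h5 := natDegree_sub_le (polePart o g δ ρ ρ' + polePart o g δ ρ' ρ) (numerator o g δ)
    have h6 := natDegree_add_le (polePart o g δ ρ ρ') (polePart o g δ ρ' ρ)
    have h7 := natDegree_polePart_lt o g hδ ρ ρ'
    have h8 := natDegree_polePart_lt o g hδ ρ' ρ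
    have h9 := natDegree_numerator_le o g hδ
    exact h5.trans_lt (max_lt (h6.trans_lt (max_lt (by omega) (by omega))) (by omega))
  exact (sub_eq_zero.1 h4).symm

/-- The expansion of the numerator at a repeated root. -/
theorem numerator_eq_sum (o : OutputKind) (g : Gains) {δ : ℕ} (hδ : 0 < δ) (ρ : ℂ) :
    numerator o g δ =
      ∑ n ∈ Finset.range (2 * δ), C (coeffRepeated o g δ ρ (n + 1)) * (X - C ρ) ^ n := by
  have h1 : ((numerator o g δ).comp (X + C ρ)).natDegree < 2 * δ := by
    rw [natDegree_comp, natDegree_X_add_C, mul_one]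
    have := natDegree_numerator_le o g hδ
    omega
  have h2 := congrArg (fun p => comp p (X - C ρ)) (as_sum_range' _ _ h1)
  simp only [coeff_numerator_comp o g hδ, comp_assoc, add_comp, X_comp, C_comp, sub_add_cancel,
    comp_X, sum_comp, monomial_comp] at h2
  exact h2

end PartialFractions

/-! ### The substitution `s = 1 / z` and the pole expansion of the responses -/

section Reflection

open Polynomial

theorem reflect_one_X_sub_C (ρ : ℂ) : reflect 1 (X - C ρ) = 1 - C ρ * X := by
  rw [reflect_sub, reflect_one_X, reflect_C, pow_one]

theorem reflect_pow_of_natDegree_le_one {p : ℂ[X]} (hp : p.natDegree ≤ 1) (a : ℕ) :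
    reflect a (p ^ a) = reflect 1 p ^ a := by
  induction a with
  | zero => simp
  | succ a ih =>
    rw [pow_succ, reflect_mul _ _ (by simpa using natDegree_pow_le_of_le a hp) hp, ih, pow_succ]

theorem reflect_term (c ρ ρ' : ℂ) (a b e : ℕ) :
    reflect (a + b + e) (C c * (X - C ρ) ^ a * (X - C ρ') ^ b) =
      C c * (X ^ e * (1 - C ρ * X) ^ a * (1 - C ρ' * X) ^ b) := by
  have h (ρ : ℂ) (a : ℕ) : ((X - C ρ) ^ a).natDegree ≤ a := by
    simp
  have h1 := reflect_mul ((X - C ρ) ^ a * (X - C ρ') ^ b) 1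
    (natDegree_mul_le_of_le (h ρ a) (h ρ' b)) (natDegree_one.le.trans (Nat.zero_le e))
  rw [mul_one, reflect_one, reflect_mul _ _ (h ρ a) (h ρ' b),
    reflect_pow_of_natDegree_le_one (natDegree_X_sub_C_le _),
    reflect_pow_of_natDegree_le_one (natDegree_X_sub_C_le _), reflect_one_X_sub_C,
    reflect_one_X_sub_C] at h1
  rw [mul_assoc, reflect_C_mul, h1]
  ring

/-- The substitution `s = 1 / z` in the numerator. -/
theorem reflect_numerator (o : OutputKind) (g : Gains) {δ : ℕ} (hδ : 0 < δ) :
    reflect (2 * δ - 1) (numerator o g δ) =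
      X ^ o.lag * (C (g.γd : ℂ) * X + C (g.γp : ℂ) * X ^ 2) ^ (δ - 1) := by
  obtain ⟨m, rfl⟩ : ∃ m, δ = m + 1 := ⟨δ - 1, by omega⟩
  rw [show 2 * (m + 1) - 1 = 1 + (m + m) by omega, Nat.add_sub_cancel]
  have h1 : (C (g.γp : ℂ) + C (g.γd : ℂ) * X).natDegree ≤ 1 := by compute_degree
  have h2 : ((C (g.γp : ℂ) + C (g.γd : ℂ) * X) ^ m).natDegree ≤ m := by
    simpa using natDegree_pow_le_of_le m h1
  have h3 : reflect (m + m) ((C (g.γp : ℂ) + C (g.γd : ℂ) * X) ^ m) =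
      (C (g.γd : ℂ) * X + C (g.γp : ℂ) * X ^ 2) ^ m := by
    have h := reflect_mul _ 1 h2 (natDegree_one.le.trans (Nat.zero_le m))
    rw [mul_one, reflect_one, reflect_pow_of_natDegree_le_one h1, reflect_add, reflect_C_mul,
      reflect_one_X, reflect_C, pow_one, ← mul_pow] at h
    rw [h]
    ring
  have h4 : ((C (g.γp : ℂ) + C (g.γd : ℂ) * X) ^ m).natDegree ≤ m + m := by omega
  cases o with
  | position =>
    simp only [numerator, OutputKind.lag, Nat.add_sub_cancel]
    rw [reflect_mul _ _ (natDegree_one.le.trans zero_le_one) h4, h3, reflect_one]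
  | velocity =>
    simp only [numerator, OutputKind.lag, Nat.add_sub_cancel]
    rw [reflect_mul _ _ natDegree_X_le h4, h3, reflect_one_X, pow_zero]

theorem reflect_sum {α : Type*} (N : ℕ) (s : Finset α) (p : α → ℂ[X]) :
    reflect N (∑ a ∈ s, p a) = ∑ a ∈ s, reflect N (p a) := by
  classical
  induction s using Finset.induction_on with
  | empty => simp
  | insert a s ha ih => rw [Finset.sum_insert ha, Finset.sum_insert ha, reflect_add, ih]

theorem reflect_polePart (o : OutputKind) (g : Gains) {δ : ℕ} (ρ ρ' : ℂ) :
    reflect (2 * δ - 1) (polePart o g δ ρ ρ') =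
      ∑ n ∈ Finset.range δ, C (distinctHalf o g δ ρ ρ' (n + 1)) *
        (X ^ (δ - (n + 1)) * (1 - C ρ * X) ^ n * (1 - C ρ' * X) ^ δ) := by
  rw [polePart, reflect_sum]
  refine Finset.sum_congr rfl fun n hn => ?_
  rw [Finset.mem_range] at hn
  rw [← reflect_term, show n + δ + (δ - (n + 1)) = 2 * δ - 1 by omega]

end Reflection

section PoleExpansion

open PowerSeries

theorem pow_mul_geomPow (ρ : ℂ) {δ n : ℕ} (hn : n < δ) :
    (1 - C ρ * X) ^ δ * geomPow ρ (δ - (n + 1)) = (1 - C ρ * X) ^ n := by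
  obtain ⟨j, rfl⟩ : ∃ j, δ = n + (j + 1) := ⟨δ - (n + 1), by omega⟩
  rw [show n + (j + 1) - (n + 1) = j by omega, pow_add, mul_assoc, mul_comm _ (geomPow ρ j),
    geomPow_mul_pow, mul_one]

theorem one_sub_C_mul_X_ne_zero (ρ : ℂ) : (1 - C ρ * X : ℂ⟦X⟧) ≠ 0 := by
  intro h
  simpa using congrArg constantCoeff h

theorem coe_polynomial_sum {α : Type*} (s : Finset α) (p : α → Polynomial ℂ) :
    ((∑ a ∈ s, p a : Polynomial ℂ) : ℂ⟦X⟧) = ∑ a ∈ s, (p a : ℂ⟦X⟧) :=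
  map_sum Polynomial.coeToPowerSeries.ringHom p s

theorem X_pow_lag_mul_gainSeries_pow (o : OutputKind) (g : Gains) {δ : ℕ} (hδ : 0 < δ) :
    X ^ o.lag * gainSeries g ^ (δ - 1) =
      ((Polynomial.reflect (2 * δ - 1) (numerator o g δ) : Polynomial ℂ) : ℂ⟦X⟧) := by
  rw [reflect_numerator o g hδ, gainSeries]
  simp

theorem coe_reflect_polePart (o : OutputKind) (g : Gains) {δ : ℕ} (ρ ρ' : ℂ) :
    ((Polynomial.reflect (2 * δ - 1) (polePart o g δ ρ ρ') : Polynomial ℂ) : ℂ⟦X⟧) =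
      ((1 - C ρ * X) * (1 - C ρ' * X)) ^ δ * ∑ n ∈ Finset.range δ,
        C (distinctHalf o g δ ρ ρ' (n + 1)) * (X ^ (δ - (n + 1)) * geomPow ρ (δ - (n + 1))) := by
  rw [reflect_polePart, coe_polynomial_sum, Finset.mul_sum]
  refine Finset.sum_congr rfl fun n hn => ?_
  rw [mul_pow]
  simp only [Polynomial.coe_mul, Polynomial.coe_pow, Polynomial.coe_sub, Polynomial.coe_one,
    Polynomial.coe_X, Polynomial.coe_C]
  rw [← pow_mul_geomPow ρ (Finset.mem_range.1 hn)]
  ring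

theorem coe_reflect_numerator_repeated (o : OutputKind) (g : Gains) {δ : ℕ} (hδ : 0 < δ) (ρ : ℂ) :
    ((Polynomial.reflect (2 * δ - 1) (numerator o g δ) : Polynomial ℂ) : ℂ⟦X⟧) =
      ((1 - C ρ * X) * (1 - C ρ * X)) ^ δ * ∑ n ∈ Finset.range (2 * δ),
        C (coeffRepeated o g δ ρ (n + 1)) *
          (X ^ (2 * δ - (n + 1)) * geomPow ρ (2 * δ - (n + 1))) := by
  rw [numerator_eq_sum o g hδ ρ, reflect_sum, coe_polynomial_sum, Finset.mul_sum]
  refine Finset.sum_congr rfl fun n hn => ?_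
  rw [Finset.mem_range] at hn
  have h := reflect_term (coeffRepeated o g δ ρ (n + 1)) ρ ρ n 0 (2 * δ - (n + 1))
  rw [show n + 0 + (2 * δ - (n + 1)) = 2 * δ - 1 by omega, pow_zero, pow_zero, mul_one,
    mul_one] at h
  rw [h, ← sq, ← pow_mul]
  simp only [Polynomial.coe_mul, Polynomial.coe_pow, Polynomial.coe_sub, Polynomial.coe_one,
    Polynomial.coe_X, Polynomial.coe_C]
  rw [← pow_mul_geomPow ρ hn]
  ring

theorem sum_range_succ_eq_sum_Icc {M : Type*} [AddCommMonoid M] (f : ℕ → M) (n : ℕ) :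
    ∑ i ∈ Finset.range n, f (i + 1) = ∑ i ∈ Finset.Icc 1 n, f i := by
  rw [Finset.range_eq_Ico, Finset.sum_Ico_add' f 0 n 1]
  rfl

/-- The response of a Jordan block with distinct roots. -/
theorem impulseResponse_jordanBlock_of_ne (o : OutputKind) {g : Gains} {a ρ₁ ρ₂ : ℂ}
    (hρ : AreRoots g a ρ₁ ρ₂) (hne : ρ₁ ≠ ρ₂) {s : ℕ} {p q : Fin s} (hpq : p ≤ q) {σ : ℕ}
    (hσ : σ = q.val - p.val + 1) (t : ℝ) :
    impulseResponse o g (jordanBlock a s) t p q = (-1) ^ (σ - 1) * ∑ ζ ∈ Finset.Icc 1 σ,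
      (coeffDistinct o g σ ρ₁ ρ₂ ζ * expMonomial ρ₁ (σ - ζ) t +
        coeffDistinct o g σ ρ₁ ρ₂ (ζ + σ) * expMonomial ρ₂ (σ - ζ) t) := by
  have hle : p.val ≤ q.val := hpq
  have hV := velocitySeries_mul hρ q (σ - 1) p (by omega)
  rw [show σ - 1 + 1 = σ by omega] at hV
  have h1 : X ^ o.lag * velocitySeries g a s p q = C ((-1) ^ (σ - 1)) *
      ((∑ n ∈ Finset.range σ, C (distinctHalf o g σ ρ₁ ρ₂ (n + 1)) *
        (X ^ (σ - (n + 1)) * geomPow ρ₁ (σ - (n + 1)))) +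
      ∑ n ∈ Finset.range σ, C (distinctHalf o g σ ρ₂ ρ₁ (n + 1)) *
        (X ^ (σ - (n + 1)) * geomPow ρ₂ (σ - (n + 1)))) := by
    refine mul_left_cancel₀ (pow_ne_zero σ (mul_ne_zero (one_sub_C_mul_X_ne_zero ρ₁)
      (one_sub_C_mul_X_ne_zero ρ₂))) ?_
    rw [mul_left_comm, hV, mul_left_comm, X_pow_lag_mul_gainSeries_pow o g (by omega),
      numerator_eq_polePart_add o g (by omega) hne, Polynomial.reflect_add, Polynomial.coe_add,
      coe_reflect_polePart, coe_reflect_polePart, mul_left_comm _ (C _),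
      mul_comm (1 - C ρ₂ * X) (1 - C ρ₁ * X), ← mul_add, map_pow, map_neg, map_one]
  have h2 := ((IsEGF.sum (Finset.range σ) fun n _ =>
    (isEGF_expMonomial ρ₁ (σ - (n + 1))).C_mul (distinctHalf o g σ ρ₁ ρ₂ (n + 1))).add
    (IsEGF.sum (Finset.range σ) fun n _ =>
    (isEGF_expMonomial ρ₂ (σ - (n + 1))).C_mul (distinctHalf o g σ ρ₂ ρ₁ (n + 1)))).C_mul
      ((-1) ^ (σ - 1))
  have h3 := isEGF_impulseResponse o g a p q
  rw [h1] at h3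
  rw [congrFun (h3.unique h2) t, ← Finset.sum_add_distrib, ← sum_range_succ_eq_sum_Icc]
  congr 1
  refine Finset.sum_congr rfl fun n hn => ?_
  rw [Finset.mem_range] at hn
  rw [coeffDistinct, if_pos (by omega), coeffDistinct, if_neg (by omega), Nat.add_sub_cancel]

/-- The response of a Jordan block with a repeated root. -/
theorem impulseResponse_jordanBlock_of_eq (o : OutputKind) {g : Gains} {a ρ : ℂ}
    (hρ : AreRoots g a ρ ρ) {s : ℕ} {p q : Fin s} (hpq : p ≤ q) {σ : ℕ}
    (hσ : σ = q.val - p.val + 1) (t : ℝ) :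
    impulseResponse o g (jordanBlock a s) t p q = (-1) ^ (σ - 1) * ∑ ζ ∈ Finset.Icc 1 (2 * σ),
      coeffRepeated o g σ ρ ζ * expMonomial ρ (2 * σ - ζ) t := by
  have hle : p.val ≤ q.val := hpq
  have hV := velocitySeries_mul hρ q (σ - 1) p (by omega)
  rw [show σ - 1 + 1 = σ by omega] at hV
  have h1 : X ^ o.lag * velocitySeries g a s p q = C ((-1) ^ (σ - 1)) *
      ∑ n ∈ Finset.range (2 * σ), C (coeffRepeated o g σ ρ (n + 1)) *
        (X ^ (2 * σ - (n + 1)) * geomPow ρ (2 * σ - (n + 1))) := by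
    refine mul_left_cancel₀ (pow_ne_zero σ (mul_ne_zero (one_sub_C_mul_X_ne_zero ρ)
      (one_sub_C_mul_X_ne_zero ρ))) ?_
    rw [mul_left_comm, hV, mul_left_comm, X_pow_lag_mul_gainSeries_pow o g (by omega),
      coe_reflect_numerator_repeated o g (by omega) ρ, mul_left_comm _ (C _)]
    simp
  have h2 := (IsEGF.sum (Finset.range (2 * σ)) fun n _ =>
    (isEGF_expMonomial ρ (2 * σ - (n + 1))).C_mul (coeffRepeated o g σ ρ (n + 1))).C_mul
      ((-1) ^ (σ - 1))
  have h3 := isEGF_impulseResponse o g a p q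
  rw [h1] at h3
  rw [congrFun (h3.unique h2) t, ← sum_range_succ_eq_sum_Icc]

end PoleExpansion

/-! ### Scalar products of exponential polynomials -/

section Pairing

theorem expMonomial_zero (ρ : ℂ) (t : ℝ) : expMonomial ρ 0 t = Complex.exp (ρ * t) := by
  simp [expMonomial]

theorem hasDerivAt_exp_mul_ofReal (ρ : ℂ) (t : ℝ) :
    HasDerivAt (fun t : ℝ => Complex.exp (ρ * t)) (ρ * Complex.exp (ρ * t)) t := by
  have h := ((hasDerivAt_id (t : ℂ)).const_mul ρ).cexp.comp_ofReal
  simpa [mul_comm] using h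

theorem hasDerivAt_expMonomial_succ (ρ : ℂ) (j : ℕ) (t : ℝ) :
    HasDerivAt (expMonomial ρ (j + 1)) (expMonomial ρ j t + ρ * expMonomial ρ (j + 1) t) t := by
  have h1 := (((hasDerivAt_id (t : ℂ)).comp_ofReal.pow (j + 1)).div_const
    ((j + 1).factorial : ℂ)).mul (hasDerivAt_exp_mul_ofReal ρ t)
  refine h1.congr_deriv ?_
  have h2 : ((j : ℂ) + 1) ≠ 0 := by exact_mod_cast Nat.succ_ne_zero j
  have h3 : (j.factorial : ℂ) ≠ 0 := by exact_mod_cast j.factorial_ne_zero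
  simp only [expMonomial, Nat.factorial_succ, Nat.add_sub_cancel, id, Pi.pow_apply]
  push_cast
  field_simp

theorem integrableOn_expMonomial {ρ : ℂ} (hρ : ρ.re < 0) (j : ℕ) :
    IntegrableOn (expMonomial ρ j) (Set.Ioi 0) := by
  have h := (integrableOn_rpow_mul_exp_neg_mul_rpow (p := 1) (s := j) (b := -ρ.re)
    (by have : (0 : ℝ) ≤ j := j.cast_nonneg; linarith) one_pos (by linarith)).const_mul
    ((j.factorial : ℝ)⁻¹)
  refine Integrable.mono' h ?_ ?_
  · refine Continuous.aestronglyMeasurable ?_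
    unfold expMonomial
    fun_prop
  · refine (ae_restrict_iff' measurableSet_Ioi).2 (Filter.Eventually.of_forall fun t ht => ?_)
    rw [expMonomial, norm_mul, norm_div, norm_pow, Complex.norm_real, Complex.norm_natCast,
      Complex.norm_exp, Real.norm_of_nonneg (le_of_lt ht), Real.rpow_one, Real.rpow_natCast]
    simp only [Complex.mul_re, Complex.ofReal_re, Complex.ofReal_im, mul_zero, sub_zero, neg_neg]
    exact le_of_eq (by ring)

theorem integral_expMonomial {ρ : ℂ} (hρ : ρ.re < 0) (j : ℕ) :
    ∫ t in Set.Ioi (0 : ℝ), expMonomial ρ j t = 1 / (-ρ) ^ (j + 1) := by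
  have h0 : ρ ≠ 0 := fun h => by simp [h] at hρ
  -- a stable exponential polynomial tends to zero, so the integral of its derivative is explicit
  have key (f f' : ℝ → ℂ) (hd : ∀ t, HasDerivAt f (f' t) t) (hf : IntegrableOn f (Set.Ioi 0))
      (hf' : IntegrableOn f' (Set.Ioi 0)) : ∫ t in Set.Ioi (0 : ℝ), f' t = -f 0 := by
    have h := integral_Ioi_of_hasDerivAt_of_tendsto (hd 0).continuousAt.continuousWithinAt
      (fun t _ => hd t) hf' (tendsto_zero_of_hasDerivAt_of_integrableOn_Ioi (fun t _ => hd t) hf' hf)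
    rw [h, zero_sub]
  induction j with
  | zero =>
    have hd (t : ℝ) : HasDerivAt (expMonomial ρ 0) (ρ * expMonomial ρ 0 t) t := by
      have h := hasDerivAt_exp_mul_ofReal ρ t
      simpa only [← expMonomial_zero] using h
    have h := key _ _ hd (integrableOn_expMonomial hρ 0)
      ((integrableOn_expMonomial hρ 0).const_mul ρ)
    rw [integral_const_mul, expMonomial_zero] at h
    simp only [Complex.ofReal_zero, mul_zero, Complex.exp_zero] at h
    rw [zero_add, pow_one, eq_div_iff (neg_ne_zero.2 h0)]
    linear_combination -h
  | succ j ih =>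
    have h := key _ _ (hasDerivAt_expMonomial_succ ρ j) (integrableOn_expMonomial hρ (j + 1))
      ((integrableOn_expMonomial hρ j).add ((integrableOn_expMonomial hρ (j + 1)).const_mul ρ))
    rw [integral_add (integrableOn_expMonomial hρ j)
      ((integrableOn_expMonomial hρ (j + 1)).const_mul ρ), integral_const_mul, ih] at h
    have h1 : expMonomial ρ (j + 1) 0 = 0 := by simp [expMonomial]
    have h2 : (-ρ) ^ (j + 1) ≠ 0 := pow_ne_zero _ (neg_ne_zero.2 h0)
    rw [h1, neg_zero] at h
    rw [pow_succ, eq_div_iff (mul_ne_zero h2 (neg_ne_zero.2 h0))]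
    have h3 : 1 / (-ρ) ^ (j + 1) * (-ρ) ^ (j + 1) = 1 := one_div_mul_cancel h2
    linear_combination (-(-ρ) ^ (j + 1)) * h + h3

/-- `I` is the scalar product `∫₀^∞ conj(f(t)) h(t) dt`, which converges absolutely. -/
def HasPairing (f h : ℝ → ℂ) (I : ℂ) : Prop :=
  IntegrableOn (fun t => star (f t) * h t) (Set.Ioi 0) ∧
    ∫ t in Set.Ioi (0 : ℝ), star (f t) * h t = I

namespace HasPairing

variable {f f' h h' : ℝ → ℂ} {I I' : ℂ}

theorem add_left (H : HasPairing f h I) (H' : HasPairing f' h I') :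
    HasPairing (fun t => f t + f' t) h (I + I') := by
  have e : (fun t => star (f t + f' t) * h t) =
      fun t => star (f t) * h t + star (f' t) * h t := by
    funext t; rw [star_add, add_mul]
  refine ⟨e ▸ H.1.add H'.1, ?_⟩
  rw [e, integral_add H.1 H'.1, H.2, H'.2]

theorem add_right (H : HasPairing f h I) (H' : HasPairing f h' I') :
    HasPairing f (fun t => h t + h' t) (I + I') := by
  have e : (fun t => star (f t) * (h t + h' t)) =
      fun t => star (f t) * h t + star (f t) * h' t := by
    funext t; rw [mul_add]
  refine ⟨e ▸ H.1.add H'.1, ?_⟩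
  rw [e, integral_add H.1 H'.1, H.2, H'.2]

theorem mul_left (c : ℂ) (H : HasPairing f h I) :
    HasPairing (fun t => c * f t) h (star c * I) := by
  have e : (fun t => star (c * f t) * h t) = fun t => star c * (star (f t) * h t) := by
    funext t; rw [star_mul']; ring
  refine ⟨e ▸ H.1.const_mul _, ?_⟩
  rw [e, integral_const_mul, H.2]

theorem mul_right (c : ℂ) (H : HasPairing f h I) :
    HasPairing f (fun t => c * h t) (c * I) := by
  have e : (fun t => star (f t) * (c * h t)) = fun t => c * (star (f t) * h t) := by
    funext t; ring
  refine ⟨e ▸ H.1.const_mul _, ?_⟩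
  rw [e, integral_const_mul, H.2]

theorem sum_left {α : Type*} (s : Finset α) {f : α → ℝ → ℂ} {I : α → ℂ}
    (H : ∀ a ∈ s, HasPairing (f a) h (I a)) :
    HasPairing (fun t => ∑ a ∈ s, f a t) h (∑ a ∈ s, I a) := by
  have e : (fun t => star (∑ a ∈ s, f a t) * h t) = fun t => ∑ a ∈ s, star (f a t) * h t := by
    funext t; rw [star_sum, Finset.sum_mul]
  refine ⟨e ▸ integrable_finsetSum s fun a ha => (H a ha).1, ?_⟩
  rw [e, integral_finsetSum s fun a ha => (H a ha).1]
  exact Finset.sum_congr rfl fun a ha => (H a ha).2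

theorem sum_right {α : Type*} (s : Finset α) {h : α → ℝ → ℂ} {I : α → ℂ}
    (H : ∀ a ∈ s, HasPairing f (h a) (I a)) :
    HasPairing f (fun t => ∑ a ∈ s, h a t) (∑ a ∈ s, I a) := by
  have e : (fun t => star (f t) * ∑ a ∈ s, h a t) = fun t => ∑ a ∈ s, star (f t) * h a t := by
    funext t; rw [Finset.mul_sum]
  refine ⟨e ▸ integrable_finsetSum s fun a ha => (H a ha).1, ?_⟩
  rw [e, integral_finsetSum s fun a ha => (H a ha).1]
  exact Finset.sum_congr rfl fun a ha => (H a ha).2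

end HasPairing

theorem star_expMonomial_mul_expMonomial (ρ ρ' : ℂ) (j j' : ℕ) (t : ℝ) :
    star (expMonomial ρ j t) * expMonomial ρ' j' t =
      ((j + j').choose j : ℂ) * expMonomial (star ρ + ρ') (j + j') t := by
  have h1 : star (expMonomial ρ j t) = expMonomial (star ρ) j t := by
    simp only [expMonomial, Complex.star_def, map_mul, map_div₀, map_pow, Complex.conj_ofReal,
      ← Complex.exp_conj, Complex.conj_natCast]
  have h2 : (j.factorial : ℂ) ≠ 0 := by exact_mod_cast j.factorial_ne_zero
  have h3 : (j'.factorial : ℂ) ≠ 0 := by exact_mod_cast j'.factorial_ne_zero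
  have h4 : ((j + j').factorial : ℂ) ≠ 0 := by exact_mod_cast (j + j').factorial_ne_zero
  rw [h1, Nat.cast_add_choose, expMonomial, expMonomial, expMonomial, add_mul, Complex.exp_add]
  field_simp
  ring

/-- The scalar product of two exponential monomials. -/
theorem hasPairing_expMonomial {ρ ρ' : ℂ} (hρ : ρ.re < 0) (hρ' : ρ'.re < 0) {S U ζ r : ℕ}
    (hζ : ζ ∈ Finset.Icc 1 S) (hr : r ∈ Finset.Icc 1 U) :
    HasPairing (expMonomial ρ (S - ζ)) (expMonomial ρ' (U - r))
      ((-1) ^ (S + U) * (Phi ζ r S U / (star ρ + ρ') ^ (S + U - ζ - r + 1))) := by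
  rw [Finset.mem_Icc] at hζ hr
  have hre : (star ρ + ρ').re < 0 := by
    simp only [Complex.add_re, Complex.star_def, Complex.conj_re]
    linarith
  have e : (fun t => star (expMonomial ρ (S - ζ) t) * expMonomial ρ' (U - r) t) =
      fun t => (((S - ζ) + (U - r)).choose (S - ζ) : ℂ) *
        expMonomial (star ρ + ρ') ((S - ζ) + (U - r)) t :=
    funext fun t => star_expMonomial_mul_expMonomial _ _ _ _ t
  refine ⟨e ▸ (integrableOn_expMonomial hre _).const_mul _, ?_⟩
  rw [e, integral_const_mul, integral_expMonomial hre, Nat.cast_add_choose, Phi]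
  obtain ⟨j, rfl⟩ : ∃ j, S = ζ + j := ⟨S - ζ, by omega⟩
  obtain ⟨k, rfl⟩ : ∃ k, U = r + k := ⟨U - r, by omega⟩
  rw [show ζ + j - ζ = j by omega, show r + k - r = k by omega,
    show ζ + j + (r + k) - ζ - r = j + k by omega]
  have hA : (star ρ + ρ') ≠ 0 := fun h => by rw [h] at hre; simp at hre
  have hsign : (-1 : ℂ) ^ (ζ + j + (r + k)) * (-1 : ℂ) ^ (1 - (ζ : ℤ) - (r : ℤ)) =
      (-1) ^ (j + k + 1) := by
    rw [← zpow_natCast, ← zpow_natCast, ← zpow_add₀ (by norm_num)]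
    congr 1
    push_cast
    ring
  have hsq : (-1 : ℂ) ^ (j + k + 1) * (-1 : ℂ) ^ (j + k + 1) = 1 := by
    rw [← mul_pow]; norm_num
  have h1 : 1 / (-(star ρ + ρ')) ^ (j + k + 1) =
      (-1) ^ (j + k + 1) / (star ρ + ρ') ^ (j + k + 1) := by
    rw [neg_pow, div_eq_div_iff (mul_ne_zero (pow_ne_zero _ (by norm_num)) (pow_ne_zero _ hA))
      (pow_ne_zero _ hA)]
    linear_combination (-(star ρ + ρ') ^ (j + k + 1)) * hsq
  rw [h1, ← hsign]
  ring

end Pairing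

/-! ### Stability of integrable responses -/

section Stability

theorem re_neg_of_integrableOn_expMonomial {ρ : ℂ}
    (h : IntegrableOn (expMonomial ρ 0) (Set.Ioi 0)) : ρ.re < 0 := by
  by_contra hcon
  have h1 : IntegrableOn (fun _ : ℝ => (1 : ℝ)) (Set.Ioi 0) := by
    refine Integrable.mono' h.norm aestronglyMeasurable_const ?_
    refine (ae_restrict_iff' measurableSet_Ioi).2 (Filter.Eventually.of_forall fun t ht => ?_)
    rw [expMonomial_zero, Complex.norm_exp, norm_one]
    apply Real.one_le_exp
    simpa using mul_nonneg (not_lt.1 hcon) (le_of_lt ht)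
  rw [integrableOn_const_iff (by simp)] at h1
  simp at h1

theorem integrableOn_comp_add_right {f : ℝ → ℂ} (hf : IntegrableOn f (Set.Ioi 0)) {τ : ℝ}
    (hτ : 0 ≤ τ) : IntegrableOn (fun t => f (t + τ)) (Set.Ioi 0) := by
  have h := (measurePreserving_add_right volume τ).integrableOn_comp_preimage
    (Homeomorph.addRight τ).measurableEmbedding (f := f) (s := Set.Ioi 0)
  refine (h.2 hf).mono_set fun t ht => ?_
  simp only [Set.mem_Ioi, Set.mem_preimage] at ht ⊢
  linarith

theorem expMonomial_zero_add (ρ : ℂ) (t τ : ℝ) :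
    expMonomial ρ 0 (t + τ) = Complex.exp (ρ * τ) * expMonomial ρ 0 t := by
  rw [expMonomial_zero, expMonomial_zero, ← Complex.exp_add]
  congr 1
  push_cast
  ring

/-- If `f(t) = c₁ e^{ρ₁ t} + c₂ e^{ρ₂ t}` is integrable, then so is `f(t + τ) - e^{ρ₂ τ} f(t)`, a
multiple of `e^{ρ₁ t}`. -/
theorem re_neg_of_integrableOn_of_ne {ρ₁ ρ₂ c₁ c₂ : ℂ} (hne : ρ₁ ≠ ρ₂) (hc : c₁ ≠ 0)
    (h : IntegrableOn (fun t => c₁ * expMonomial ρ₁ 0 t + c₂ * expMonomial ρ₂ 0 t) (Set.Ioi 0)) :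
    ρ₁.re < 0 := by
  have hd : 0 < ‖ρ₁ - ρ₂‖ := norm_pos_iff.2 (sub_ne_zero.2 hne)
  -- the exponents differ by a complex number of modulus one, so the exponentials differ
  set τ : ℝ := ‖ρ₁ - ρ₂‖⁻¹ with hτ
  have hexp : Complex.exp (ρ₁ * τ) - Complex.exp (ρ₂ * τ) ≠ 0 := by
    intro h0
    have h1 : Complex.exp ((ρ₁ - ρ₂) * τ) = Complex.exp 0 := by
      rw [sub_mul, Complex.exp_sub, sub_eq_zero.1 h0, div_self (Complex.exp_ne_zero _),
        Complex.exp_zero]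
    have h2 : ‖(ρ₁ - ρ₂) * (τ : ℂ)‖ = 1 := by
      rw [norm_mul, Complex.norm_real, hτ, norm_inv, norm_norm, mul_inv_cancel₀ hd.ne']
    have h3 := abs_le.1 ((Complex.abs_im_le_norm _).trans h2.le)
    have hπ := Real.pi_gt_three
    have h4 := Complex.exp_inj_of_neg_pi_lt_of_le_pi (by linarith [h3.1]) (by linarith [h3.2])
      (by simp [Real.pi_pos]) (by simp [Real.pi_pos.le]) h1
    rw [h4, norm_zero] at h2
    exact zero_ne_one h2
  have h1 := (integrableOn_comp_add_right h (inv_nonneg.2 hd.le)).sub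
    (h.const_mul (Complex.exp (ρ₂ * τ)))
  have h2 := h1.const_mul (c₁ * (Complex.exp (ρ₁ * τ) - Complex.exp (ρ₂ * τ)))⁻¹
  refine re_neg_of_integrableOn_expMonomial (h2.congr (Filter.Eventually.of_forall fun t => ?_))
  simp only [Pi.sub_apply, ← hτ, expMonomial_zero_add]
  rw [inv_mul_eq_iff_eq_mul₀ (mul_ne_zero hc hexp)]
  ring

/-- If `f(t) = (c₁ t + c₂) e^{ρ t}` is integrable, then so is `f(t + 1) - e^ρ f(t)`, a multiple of
`e^{ρ t}`. -/
theorem re_neg_of_integrableOn_of_eq {ρ c₁ c₂ : ℂ} (hc : c₁ ≠ 0)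
    (h : IntegrableOn (fun t => c₁ * expMonomial ρ 1 t + c₂ * expMonomial ρ 0 t) (Set.Ioi 0)) :
    ρ.re < 0 := by
  have h1 := (integrableOn_comp_add_right h zero_le_one).sub (h.const_mul (Complex.exp ρ))
  have h2 := h1.const_mul (c₁ * Complex.exp ρ)⁻¹
  refine re_neg_of_integrableOn_expMonomial (h2.congr (Filter.Eventually.of_forall fun t => ?_))
  have h3 (t : ℝ) : expMonomial ρ 1 t = t * expMonomial ρ 0 t := by simp [expMonomial]
  simp only [Pi.sub_apply, h3, expMonomial_zero_add, Complex.ofReal_one, mul_one]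
  rw [inv_mul_eq_iff_eq_mul₀ (mul_ne_zero hc (Complex.exp_ne_zero _))]
  push_cast
  ring

/-- An integrable diagonal response of a Jordan block has both roots in the open left half-plane.
The assumption excludes the cancellation of a root `0` by the zero of `r(s) = s`. -/
theorem re_neg_of_integrableOn_impulseResponse (o : OutputKind) {g : Gains} {a ρ₁ ρ₂ : ℂ}
    (hρ : AreRoots g a ρ₁ ρ₂) (h0 : g.kp + g.γp * a ≠ 0) {s : ℕ} (p : Fin s)
    (h : IntegrableOn (fun t => impulseResponse o g (jordanBlock a s) t p p) (Set.Ioi 0)) :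
    ρ₁.re < 0 ∧ ρ₂.re < 0 := by
  rw [hρ.prod_eq] at h0
  have hσ : 1 = p.val - p.val + 1 := by omega
  by_cases hne : ρ₁ = ρ₂
  · subst hne
    simp only [impulseResponse_jordanBlock_of_eq o hρ le_rfl hσ] at h
    have hc : coeffRepeated o g 1 ρ₁ 1 ≠ 0 := by
      cases o <;> simp [coeffRepeated, gainFactor, (mul_ne_zero_iff.1 h0).1]
    have h1 := re_neg_of_integrableOn_of_eq (ρ := ρ₁) (c₂ := coeffRepeated o g 1 ρ₁ 2) hc
      (by simpa [Finset.sum_Icc_succ_top] using h)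
    exact ⟨h1, h1⟩
  · have hc {ρ ρ' : ℂ} (hne : ρ ≠ ρ') (hr : ρ ≠ 0) : distinctHalf o g 1 ρ ρ' 1 ≠ 0 := by
      cases o <;> simp [distinctHalf, gainFactor, tau, sub_ne_zero.2 hne, hr]
    simp only [impulseResponse_jordanBlock_of_ne o hρ hne le_rfl hσ] at h
    have h1 : IntegrableOn (fun t => distinctHalf o g 1 ρ₁ ρ₂ 1 * expMonomial ρ₁ 0 t +
        distinctHalf o g 1 ρ₂ ρ₁ 1 * expMonomial ρ₂ 0 t) (Set.Ioi 0) := by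
      simpa [coeffDistinct] using h
    refine ⟨re_neg_of_integrableOn_of_ne hne (hc hne (mul_ne_zero_iff.1 h0).1) h1,
      re_neg_of_integrableOn_of_ne (Ne.symm hne) (hc (Ne.symm hne) (mul_ne_zero_iff.1 h0).2)
      (by simpa only [add_comm] using h1)⟩

end Stability

/-! ### Scalar products of Jordan block responses -/

section BlockPairing

variable (o : OutputKind) {g : Gains} {a a' ρ₁ ρ₂ ρ₁' ρ₂' ρ ρ' : ℂ} {s s' : ℕ} {p q : Fin s}
  {p' q' : Fin s'} {σ υ : ℕ}

theorem neg_one_pow_add_of_pos (hσ : 0 < σ) (hυ : 0 < υ) :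
    (-1 : ℂ) ^ (σ + υ) = (-1) ^ (σ - 1) * (-1) ^ (υ - 1) := by
  obtain ⟨i, rfl⟩ : ∃ i, σ = i + 1 := ⟨σ - 1, by omega⟩
  obtain ⟨j, rfl⟩ : ∃ j, υ = j + 1 := ⟨υ - 1, by omega⟩
  rw [Nat.add_sub_cancel, Nat.add_sub_cancel]
  ring

theorem neg_one_pow_of_pos (hσ : 0 < σ) : (-1 : ℂ) ^ σ = -(-1) ^ (σ - 1) := by
  obtain ⟨i, rfl⟩ : ∃ i, σ = i + 1 := ⟨σ - 1, by omega⟩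
  rw [Nat.add_sub_cancel]
  ring

theorem hasPairing_of_ne_of_ne (hρ : AreRoots g a ρ₁ ρ₂) (hρ' : AreRoots g a' ρ₁' ρ₂')
    (h₁ : ρ₁.re < 0) (h₂ : ρ₂.re < 0) (h₁' : ρ₁'.re < 0) (h₂' : ρ₂'.re < 0)
    (hpq : p ≤ q) (hpq' : p' ≤ q') (hσ : σ = q.val - p.val + 1) (hυ : υ = q'.val - p'.val + 1)
    (hne : ρ₁ ≠ ρ₂) (hne' : ρ₁' ≠ ρ₂') :
    HasPairing (fun t => impulseResponse o g (jordanBlock a s) t p q)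
      (fun t => impulseResponse o g (jordanBlock a' s') t p' q')
      (∑ ζ ∈ Finset.Icc 1 σ, ∑ r ∈ Finset.Icc 1 υ,
        (Phi ζ r σ υ * star (coeffDistinct o g σ ρ₁ ρ₂ ζ) * coeffDistinct o g υ ρ₁' ρ₂' r /
            (star ρ₁ + ρ₁') ^ (σ + υ - ζ - r + 1) +
          Phi ζ r σ υ * star (coeffDistinct o g σ ρ₁ ρ₂ ζ) * coeffDistinct o g υ ρ₁' ρ₂' (r + υ) /
            (star ρ₁ + ρ₂') ^ (σ + υ - ζ - r + 1) +
          Phi ζ r σ υ * star (coeffDistinct o g σ ρ₁ ρ₂ (ζ + σ)) * coeffDistinct o g υ ρ₁' ρ₂' r /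
            (star ρ₂ + ρ₁') ^ (σ + υ - ζ - r + 1) +
          Phi ζ r σ υ * star (coeffDistinct o g σ ρ₁ ρ₂ (ζ + σ)) *
            coeffDistinct o g υ ρ₁' ρ₂' (r + υ) / (star ρ₂ + ρ₂') ^ (σ + υ - ζ - r + 1))) := by
  simp only [impulseResponse_jordanBlock_of_ne o hρ hne hpq hσ,
    impulseResponse_jordanBlock_of_ne o hρ' hne' hpq' hυ]
  have H := ((HasPairing.sum_left (Finset.Icc 1 σ) fun ζ hζ =>
    HasPairing.sum_right (Finset.Icc 1 υ) fun r hr =>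
      ((((hasPairing_expMonomial h₁ h₁' hζ hr).mul_left (coeffDistinct o g σ ρ₁ ρ₂ ζ)).mul_right
          (coeffDistinct o g υ ρ₁' ρ₂' r)).add_right
        (((hasPairing_expMonomial h₁ h₂' hζ hr).mul_left (coeffDistinct o g σ ρ₁ ρ₂ ζ)).mul_right
          (coeffDistinct o g υ ρ₁' ρ₂' (r + υ)))).add_left
      ((((hasPairing_expMonomial h₂ h₁' hζ hr).mul_left
          (coeffDistinct o g σ ρ₁ ρ₂ (ζ + σ))).mul_right (coeffDistinct o g υ ρ₁' ρ₂' r)).add_right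
        (((hasPairing_expMonomial h₂ h₂' hζ hr).mul_left
          (coeffDistinct o g σ ρ₁ ρ₂ (ζ + σ))).mul_right
            (coeffDistinct o g υ ρ₁' ρ₂' (r + υ))))).mul_left ((-1) ^ (σ - 1))).mul_right
    ((-1) ^ (υ - 1))
  convert H using 1
  simp only [star_pow, star_neg, star_one, neg_one_pow_add_of_pos (show 0 < σ by omega)
    (show 0 < υ by omega), Finset.mul_sum]
  refine Finset.sum_congr rfl fun ζ _ => Finset.sum_congr rfl fun r _ => ?_
  -- the signs of the two responses combine with the one of `hasPairing_expMonomial`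
  rcases neg_one_pow_eq_or ℂ (σ - 1) with e | e <;> rcases neg_one_pow_eq_or ℂ (υ - 1) with e' | e'
    <;> simp only [e, e'] <;> ring

theorem hasPairing_of_ne_of_eq (hρ : AreRoots g a ρ₁ ρ₂) (hρ' : AreRoots g a' ρ' ρ')
    (h₁ : ρ₁.re < 0) (h₂ : ρ₂.re < 0) (h' : ρ'.re < 0)
    (hpq : p ≤ q) (hpq' : p' ≤ q') (hσ : σ = q.val - p.val + 1) (hυ : υ = q'.val - p'.val + 1)
    (hne : ρ₁ ≠ ρ₂) :
    HasPairing (fun t => impulseResponse o g (jordanBlock a s) t p q)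
      (fun t => impulseResponse o g (jordanBlock a' s') t p' q')
      (∑ ζ ∈ Finset.Icc 1 σ, ∑ r ∈ Finset.Icc 1 (2 * υ),
        ((-1) ^ υ * Phi ζ r σ (2 * υ) * star (coeffDistinct o g σ ρ₁ ρ₂ ζ) *
            coeffRepeated o g υ ρ' r / (star ρ₁ + ρ') ^ (σ + 2 * υ - ζ - r + 1) +
          (-1) ^ υ * Phi ζ r σ (2 * υ) * star (coeffDistinct o g σ ρ₁ ρ₂ (ζ + σ)) *
            coeffRepeated o g υ ρ' r / (star ρ₂ + ρ') ^ (σ + 2 * υ - ζ - r + 1))) := by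
  simp only [impulseResponse_jordanBlock_of_ne o hρ hne hpq hσ,
    impulseResponse_jordanBlock_of_eq o hρ' hpq' hυ]
  have H := ((HasPairing.sum_left (Finset.Icc 1 σ) fun ζ hζ =>
    HasPairing.sum_right (Finset.Icc 1 (2 * υ)) fun r hr =>
      (((hasPairing_expMonomial h₁ h' hζ hr).mul_left (coeffDistinct o g σ ρ₁ ρ₂ ζ)).mul_right
          (coeffRepeated o g υ ρ' r)).add_left
      (((hasPairing_expMonomial h₂ h' hζ hr).mul_left
          (coeffDistinct o g σ ρ₁ ρ₂ (ζ + σ))).mul_right (coeffRepeated o g υ ρ' r))).mul_left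
    ((-1) ^ (σ - 1))).mul_right ((-1) ^ (υ - 1))
  convert H using 1
  simp only [star_pow, star_neg, star_one, pow_add (-1 : ℂ) σ, pow_mul, neg_one_sq, one_pow,
    neg_one_pow_of_pos (show 0 < σ by omega), neg_one_pow_of_pos (show 0 < υ by omega),
    Finset.mul_sum]
  refine Finset.sum_congr rfl fun ζ _ => Finset.sum_congr rfl fun r _ => ?_
  -- the signs of the two responses combine with the one of `hasPairing_expMonomial`
  rcases neg_one_pow_eq_or ℂ (σ - 1) with e | e <;> rcases neg_one_pow_eq_or ℂ (υ - 1) with e' | e'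
    <;> simp only [e, e'] <;> ring

theorem hasPairing_of_eq_of_ne (hρ : AreRoots g a ρ ρ) (hρ' : AreRoots g a' ρ₁' ρ₂')
    (h : ρ.re < 0) (h₁' : ρ₁'.re < 0) (h₂' : ρ₂'.re < 0)
    (hpq : p ≤ q) (hpq' : p' ≤ q') (hσ : σ = q.val - p.val + 1) (hυ : υ = q'.val - p'.val + 1)
    (hne' : ρ₁' ≠ ρ₂') :
    HasPairing (fun t => impulseResponse o g (jordanBlock a s) t p q)
      (fun t => impulseResponse o g (jordanBlock a' s') t p' q')
      (∑ ζ ∈ Finset.Icc 1 (2 * σ), ∑ r ∈ Finset.Icc 1 υ,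
        ((-1) ^ σ * Phi ζ r (2 * σ) υ * star (coeffRepeated o g σ ρ ζ) *
            coeffDistinct o g υ ρ₁' ρ₂' r / (star ρ + ρ₁') ^ (2 * σ + υ - ζ - r + 1) +
          (-1) ^ σ * Phi ζ r (2 * σ) υ * star (coeffRepeated o g σ ρ ζ) *
            coeffDistinct o g υ ρ₁' ρ₂' (r + υ) /
            (star ρ + ρ₂') ^ (2 * σ + υ - ζ - r + 1))) := by
  simp only [impulseResponse_jordanBlock_of_eq o hρ hpq hσ,
    impulseResponse_jordanBlock_of_ne o hρ' hne' hpq' hυ]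
  have H := ((HasPairing.sum_left (Finset.Icc 1 (2 * σ)) fun ζ hζ =>
    HasPairing.sum_right (Finset.Icc 1 υ) fun r hr =>
      (((hasPairing_expMonomial h h₁' hζ hr).mul_left (coeffRepeated o g σ ρ ζ)).mul_right
          (coeffDistinct o g υ ρ₁' ρ₂' r)).add_right
      (((hasPairing_expMonomial h h₂' hζ hr).mul_left (coeffRepeated o g σ ρ ζ)).mul_right
          (coeffDistinct o g υ ρ₁' ρ₂' (r + υ)))).mul_left
    ((-1) ^ (σ - 1))).mul_right ((-1) ^ (υ - 1))
  convert H using 1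
  simp only [star_pow, star_neg, star_one, pow_add (-1 : ℂ) (2 * σ), pow_mul, neg_one_sq, one_pow,
    neg_one_pow_of_pos (show 0 < σ by omega), neg_one_pow_of_pos (show 0 < υ by omega),
    Finset.mul_sum]
  refine Finset.sum_congr rfl fun ζ _ => Finset.sum_congr rfl fun r _ => ?_
  -- the signs of the two responses combine with the one of `hasPairing_expMonomial`
  rcases neg_one_pow_eq_or ℂ (σ - 1) with e | e <;> rcases neg_one_pow_eq_or ℂ (υ - 1) with e' | e'
    <;> simp only [e, e'] <;> ring

theorem hasPairing_of_eq_of_eq (hρ : AreRoots g a ρ ρ) (hρ' : AreRoots g a' ρ' ρ')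
    (h : ρ.re < 0) (h' : ρ'.re < 0)
    (hpq : p ≤ q) (hpq' : p' ≤ q') (hσ : σ = q.val - p.val + 1)
    (hυ : υ = q'.val - p'.val + 1) :
    HasPairing (fun t => impulseResponse o g (jordanBlock a s) t p q)
      (fun t => impulseResponse o g (jordanBlock a' s') t p' q')
      (∑ ζ ∈ Finset.Icc 1 (2 * σ), ∑ r ∈ Finset.Icc 1 (2 * υ),
        (-1) ^ (σ + υ) * Phi ζ r (2 * σ) (2 * υ) * star (coeffRepeated o g σ ρ ζ) *
          coeffRepeated o g υ ρ' r / (star ρ + ρ') ^ (2 * σ + 2 * υ - ζ - r + 1)) := by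
  simp only [impulseResponse_jordanBlock_of_eq o hρ hpq hσ,
    impulseResponse_jordanBlock_of_eq o hρ' hpq' hυ]
  have H := ((HasPairing.sum_left (Finset.Icc 1 (2 * σ)) fun ζ hζ =>
    HasPairing.sum_right (Finset.Icc 1 (2 * υ)) fun r hr =>
      ((hasPairing_expMonomial h h' hζ hr).mul_left (coeffRepeated o g σ ρ ζ)).mul_right
          (coeffRepeated o g υ ρ' r)).mul_left
    ((-1) ^ (σ - 1))).mul_right ((-1) ^ (υ - 1))
  convert H using 1
  simp only [star_pow, star_neg, star_one, neg_one_pow_add_of_pos (show 0 < σ by omega)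
    (show 0 < υ by omega), pow_add (-1 : ℂ) (2 * σ), pow_mul, neg_one_sq, one_pow, Finset.mul_sum]
  refine Finset.sum_congr rfl fun ζ _ => Finset.sum_congr rfl fun r _ => ?_
  -- the signs of the two responses combine with the one of `hasPairing_expMonomial`
  rcases neg_one_pow_eq_or ℂ (σ - 1) with e | e <;> rcases neg_one_pow_eq_or ℂ (υ - 1) with e' | e'
    <;> simp only [e, e'] <;> ring

/-- The scalar products of stable blocks converge absolutely. -/
theorem exists_hasPairing (hρ : AreRoots g a ρ₁ ρ₂) (hρ' : AreRoots g a' ρ₁' ρ₂')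
    (h₁ : ρ₁.re < 0) (h₂ : ρ₂.re < 0) (h₁' : ρ₁'.re < 0) (h₂' : ρ₂'.re < 0)
    (hpq : p ≤ q) (hpq' : p' ≤ q') :
    ∃ I, HasPairing (fun t => impulseResponse o g (jordanBlock a s) t p q)
      (fun t => impulseResponse o g (jordanBlock a' s') t p' q') I := by
  by_cases hne : ρ₁ = ρ₂ <;> by_cases hne' : ρ₁' = ρ₂'
  · subst hne hne'
    exact ⟨_, hasPairing_of_eq_of_eq o hρ hρ' h₁ h₁' hpq hpq' rfl rfl⟩
  · subst hne
    exact ⟨_, hasPairing_of_eq_of_ne o hρ hρ' h₁ h₁' h₂' hpq hpq' rfl rfl hne'⟩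
  · subst hne'
    exact ⟨_, hasPairing_of_ne_of_eq o hρ hρ' h₁ h₂ h₁' hpq hpq' rfl rfl hne⟩
  · exact ⟨_, hasPairing_of_ne_of_ne o hρ hρ' h₁ h₂ h₁' h₂' hpq hpq' rfl rfl hne hne'⟩

end BlockPairing

/-! ### The output in Jordan coordinates -/

namespace JordanDecomposition

variable {n q m : ℕ} {L : Matrix (Fin n) (Fin n) ℝ} (D : JordanDecomposition L m)

theorem outputResponse_mul_R (o : OutputKind) (g : Gains) (C : Matrix (Fin q) (Fin n) ℝ) (t : ℝ)
    (i : Fin q) (k : Fin (m + 1)) (p : Fin (D.size k)) :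
    ((outputResponse o g L C t).map (fun x : ℝ => (x : ℂ)) * D.R) i ⟨k, p⟩ =
      ∑ p', (C.map (fun x : ℝ => (x : ℂ)) * D.R) i ⟨k, p'⟩ *
        impulseResponse o g (jordanBlock (D.eig k) (D.size k)) t p' p := by
  have h1 : (outputResponse o g L C t).map (fun x : ℝ => (x : ℂ)) * D.R =
      C.map (fun x : ℝ => (x : ℂ)) * D.R * impulseResponse o g D.J t := by
    rw [Matrix.mul_assoc, ← impulseResponse_mul_eq_mul_impulseResponse o g D.map_mul_R t,
      impulseResponse_map_ofReal, ← Matrix.mul_assoc]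
    congr 1
    exact Matrix.map_mul (f := Complex.ofRealHom)
  rw [h1, J, impulseResponse_blockDiagonal', mul_apply, Fintype.sum_sigma,
    Finset.sum_eq_single_of_mem k (Finset.mem_univ _)]
  · simp
  · intro j _ hj
    exact Finset.sum_eq_zero fun p' _ => by rw [blockDiagonal'_apply_ne _ _ _ hj, mul_zero]

theorem isObservable_iff (C : Matrix (Fin q) (Fin n) ℝ) (k : Fin m) :
    D.IsObservable C k ↔ ∃ i p, (C.map (fun x : ℝ => (x : ℂ)) * D.Rtilde) i ⟨k, p⟩ ≠ 0 := by
  rw [IsObservable, Ne, ← Matrix.ext_iff]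
  push Not
  rfl

/-- In an observable block, the response of the output to the first observable coordinate is a
nonzero multiple of the diagonal entry of the block response, so the latter is integrable and the
roots are in the open left half-plane. -/
theorem re_neg_of_isObservable (o : OutputKind) (g : Gains) {C : Matrix (Fin q) (Fin n) ℝ}
    (hstab : IOStable (outputResponse o g L C)) {k : Fin m} (hk : D.IsObservable C k)
    {ρ₁ ρ₂ : ℂ} (hρ : AreRoots g (D.eig k.succ) ρ₁ ρ₂)
    (h0 : g.kp + g.γp * D.eig k.succ ≠ 0) : ρ₁.re < 0 ∧ ρ₂.re < 0 := by
  obtain ⟨i, p₀, hp₀⟩ := (D.isObservable_iff C k).1 hk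
  obtain ⟨p, hp, hmin⟩ := WellFounded.has_min wellFounded_lt
    {p | (C.map (fun x : ℝ => (x : ℂ)) * D.Rtilde) i ⟨k, p⟩ ≠ 0} ⟨p₀, hp₀⟩
  have hp' : (C.map (fun x : ℝ => (x : ℂ)) * D.R) i ⟨k.succ, p⟩ ≠ 0 := hp
  refine re_neg_of_integrableOn_impulseResponse o hρ h0 p ?_
  have h1 : IntegrableOn (fun t =>
      ((outputResponse o g L C t).map (fun x : ℝ => (x : ℂ)) * D.R) i ⟨k.succ, p⟩)
      (Set.Ioi 0) := by
    simp only [mul_apply, map_apply]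
    exact integrable_finsetSum _ fun j _ => (hstab i j).ofReal.mul_const _
  have h2 (t : ℝ) : ((outputResponse o g L C t).map (fun x : ℝ => (x : ℂ)) * D.R) i ⟨k.succ, p⟩ =
      (C.map (fun x : ℝ => (x : ℂ)) * D.R) i ⟨k.succ, p⟩ *
        impulseResponse o g (jordanBlock (D.eig k.succ) (D.size k.succ)) t p p := by
    rw [outputResponse_mul_R, Finset.sum_eq_single_of_mem p (Finset.mem_univ _)]
    intro p' _ hne
    rcases lt_or_gt_of_ne hne with hlt | hgt
    · have h3 : (C.map (fun x : ℝ => (x : ℂ)) * D.R) i ⟨k.succ, p'⟩ = 0 := by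
        by_contra hcon
        exact hmin p' hcon hlt
      rw [h3, zero_mul]
    · rw [impulseResponse_jordanBlock_of_lt o g _ hgt, mul_zero]
  simp only [h2] at h1
  refine (h1.const_mul ((C.map (fun x : ℝ => (x : ℂ)) * D.R) i ⟨k.succ, p⟩)⁻¹).congr
    (Filter.Eventually.of_forall fun t => ?_)
  exact inv_mul_cancel_left₀ hp' _

theorem nu_eq [NeZero n] {C : Matrix (Fin q) (Fin n) ℝ} {Θ : Matrix (Fin n) (Fin n) ℂ}
    {μ : Fin n → ℝ} (hΘ : IsOutputDiagonalization C Θ μ) (η κ : D.Index) :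
    D.nu Θ μ η κ = ∑ i, star ((C.map (fun x : ℝ => (x : ℂ)) * D.Rtilde) i η) *
      (C.map (fun x : ℝ => (x : ℂ)) * D.Rtilde) i κ := by
  have h1 : (C.map (fun x : ℝ => (x : ℂ)) * D.Rtilde)ᴴ * (C.map (fun x : ℝ => (x : ℂ)) * D.Rtilde) =
      (D.Rtildeᴴ * Θ) * Matrix.diagonal (fun i => (μ i : ℂ)) * (Θᴴ * D.Rtilde) := by
    have h2 : (C.map (fun x : ℝ => (x : ℂ)))ᴴ * C.map (fun x : ℝ => (x : ℂ)) =
        Θ * Matrix.diagonal (fun i => (μ i : ℂ)) * Θᴴ := by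
      rw [← hΘ.decomp]
      ext i j
      simp [mul_apply]
    rw [conjTranspose_mul, Matrix.mul_assoc, ← Matrix.mul_assoc _ _ D.Rtilde, h2]
    simp only [Matrix.mul_assoc]
  have h3 := congrFun (congrFun h1 η) κ
  rw [mul_apply, mul_apply] at h3
  simp only [conjTranspose_apply, mul_diagonal] at h3
  rw [h3, nu]
  rw [Finset.sum_erase]
  · refine Finset.sum_congr rfl fun l _ => ?_
    simp only [mul_apply, conjTranspose_apply]
    ring
  · rw [hΘ.eigenvalue_zero]
    simp

theorem trace_sigmaQ_mul (w₀ : Fin n → ℝ) (M : Matrix D.Index D.Index ℂ) :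
    Matrix.trace (D.sigmaQ w₀ * M) = ∑ x, ∑ y, star ((D.Qtilde *ᵥ fun i => (w₀ i : ℂ)) x) *
      (D.Qtilde *ᵥ fun i => (w₀ i : ℂ)) y * M x y := by
  have h : D.sigmaQ w₀ = vecMulVec (D.Qtilde *ᵥ fun i => (w₀ i : ℂ))
      (star (D.Qtilde *ᵥ fun i => (w₀ i : ℂ))) := by
    rw [sigmaQ, mul_vecMulVec, vecMulVec_mul, star_mulVec]
  rw [h, trace, Finset.sum_comm]
  simp only [diag_apply, mul_apply, vecMulVec_apply, Pi.star_apply]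
  refine Finset.sum_congr rfl fun x _ => Finset.sum_congr rfl fun y _ => ?_
  ring

/-- The output in Jordan coordinates, for an output matrix that annihilates the first block. -/
theorem outputResponse_mulVec (o : OutputKind) (g : Gains) {C : Matrix (Fin q) (Fin n) ℝ}
    (hC : ∀ i p, (C.map (fun x : ℝ => (x : ℂ)) * D.R) i ⟨0, p⟩ = 0) (w₀ : Fin n → ℝ) (t : ℝ)
    (i : Fin q) : (((outputResponse o g L C t *ᵥ w₀) i : ℝ) : ℂ) =
      ∑ x : D.Index, (D.Qtilde *ᵥ fun i => (w₀ i : ℂ)) x * ∑ p ∈ Finset.Iic x.2,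
        (C.map (fun x : ℝ => (x : ℂ)) * D.Rtilde) i ⟨x.1, p⟩ * D.blockResponse o g x.1 t p x.2 := by
  have h1 : (((outputResponse o g L C t *ᵥ w₀) i : ℝ) : ℂ) =
      ((outputResponse o g L C t).map (fun x : ℝ => (x : ℂ)) *ᵥ fun i => (w₀ i : ℂ)) i := by
    simp [mulVec, dotProduct]
  have h2 : (outputResponse o g L C t).map (fun x : ℝ => (x : ℂ)) *ᵥ (fun i => (w₀ i : ℂ)) =
      ((outputResponse o g L C t).map (fun x : ℝ => (x : ℂ)) * D.R) *ᵥ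
        (D.Rinv *ᵥ fun i => (w₀ i : ℂ)) := by
    rw [mulVec_mulVec, Matrix.mul_assoc, D.R_mul_Rinv, Matrix.mul_one]
  rw [h1, h2, mulVec, dotProduct, Fintype.sum_sigma, Fin.sum_univ_succ, Finset.sum_eq_zero,
    zero_add, Fintype.sum_sigma]
  · refine Finset.sum_congr rfl fun k _ => Finset.sum_congr rfl fun p _ => ?_
    rw [outputResponse_mul_R, mul_comm]
    congr 1
    refine (Finset.sum_subset (Finset.subset_univ _) fun p' _ hp' => ?_).symm
    rw [impulseResponse_jordanBlock_of_lt o g _ (by simpa using hp'), mul_zero]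
  · intro p _
    rw [outputResponse_mul_R, Finset.sum_eq_zero, zero_mul]
    intro p' _
    rw [hC, zero_mul]

/-- The squared norm of one component of the output. -/
theorem hasPairing_output (o : OutputKind) (g : Gains) {C : Matrix (Fin q) (Fin n) ℝ}
    (hC : ∀ i p, (C.map (fun x : ℝ => (x : ℂ)) * D.R) i ⟨0, p⟩ = 0)
    {ρ₁ ρ₂ : Fin m → ℂ} (hρ : ∀ k, AreRoots g (D.eig k.succ) (ρ₁ k) (ρ₂ k))
    (hneg : ∀ k, D.IsObservable C k → (ρ₁ k).re < 0 ∧ (ρ₂ k).re < 0)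
    (w₀ : Fin n → ℝ) (i : Fin q) :
    HasPairing (fun t => (((outputResponse o g L C t *ᵥ w₀) i : ℝ) : ℂ))
      (fun t => (((outputResponse o g L C t *ᵥ w₀) i : ℝ) : ℂ))
      (∑ x : D.Index, ∑ y : D.Index, star ((D.Qtilde *ᵥ fun i => (w₀ i : ℂ)) x) *
        (D.Qtilde *ᵥ fun i => (w₀ i : ℂ)) y * ∑ p ∈ Finset.Iic x.2, ∑ a ∈ Finset.Iic y.2,
          star ((C.map (fun x : ℝ => (x : ℂ)) * D.Rtilde) i ⟨x.1, p⟩) *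
            (C.map (fun x : ℝ => (x : ℂ)) * D.Rtilde) i ⟨y.1, a⟩ *
              D.scalarProduct o g y.1 x.1 a y.2 p x.2) := by
  simp only [D.outputResponse_mulVec o g hC w₀ _ i]
  have hterm (x y : D.Index) (p : Fin (D.size x.1.succ)) (hp : p ∈ Finset.Iic x.2)
      (a : Fin (D.size y.1.succ)) (ha : a ∈ Finset.Iic y.2) :
      HasPairing (fun t => (C.map (fun x : ℝ => (x : ℂ)) * D.Rtilde) i ⟨x.1, p⟩ *
          D.blockResponse o g x.1 t p x.2)
        (fun t => (C.map (fun x : ℝ => (x : ℂ)) * D.Rtilde) i ⟨y.1, a⟩ *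
          D.blockResponse o g y.1 t a y.2)
        (star ((C.map (fun x : ℝ => (x : ℂ)) * D.Rtilde) i ⟨x.1, p⟩) *
            (C.map (fun x : ℝ => (x : ℂ)) * D.Rtilde) i ⟨y.1, a⟩ *
              D.scalarProduct o g y.1 x.1 a y.2 p x.2) := by
    -- a term with a vanishing coefficient is zero, whether or not its scalar product converges
    by_cases h1 : (C.map (fun x : ℝ => (x : ℂ)) * D.Rtilde) i ⟨x.1, p⟩ = 0
    · simp [h1, HasPairing]
    by_cases h2 : (C.map (fun x : ℝ => (x : ℂ)) * D.Rtilde) i ⟨y.1, a⟩ = 0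
    · simp [h2, HasPairing]
    obtain ⟨hx₁, hx₂⟩ := hneg x.1 ((D.isObservable_iff C x.1).2 ⟨i, p, h1⟩)
    obtain ⟨hy₁, hy₂⟩ := hneg y.1 ((D.isObservable_iff C y.1).2 ⟨i, a, h2⟩)
    obtain ⟨I, hI⟩ := exists_hasPairing o (hρ x.1) (hρ y.1) hx₁ hx₂ hy₁ hy₂
      (Finset.mem_Iic.1 hp) (Finset.mem_Iic.1 ha)
    have hI' : HasPairing (fun t => D.blockResponse o g x.1 t p x.2)
        (fun t => D.blockResponse o g y.1 t a y.2) (D.scalarProduct o g y.1 x.1 a y.2 p x.2) :=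
      ⟨hI.1, rfl⟩
    convert (hI'.mul_left _).mul_right _ using 1
    ring
  have H := HasPairing.sum_left Finset.univ fun (x : D.Index) _ =>
    HasPairing.sum_right Finset.univ fun (y : D.Index) _ =>
      ((HasPairing.sum_left (Finset.Iic x.2) fun p hp =>
        HasPairing.sum_right (Finset.Iic y.2) fun a ha => hterm x y p hp a ha).mul_left
          ((D.Qtilde *ᵥ fun i => (w₀ i : ℂ)) x)).mul_right
          ((D.Qtilde *ᵥ fun i => (w₀ i : ℂ)) y)
  convert H using 1
  refine Finset.sum_congr rfl fun x _ => Finset.sum_congr rfl fun y _ => ?_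
  ring

/-- The trace formula for the performance. -/
theorem performance_eq_trace [NeZero n] (o : OutputKind) (g : Gains)
    {C : Matrix (Fin q) (Fin n) ℝ}
    (hC : ∀ i p, (C.map (fun x : ℝ => (x : ℂ)) * D.R) i ⟨0, p⟩ = 0)
    {ρ₁ ρ₂ : Fin m → ℂ} (hρ : ∀ k, AreRoots g (D.eig k.succ) (ρ₁ k) (ρ₂ k))
    (hneg : ∀ k, D.IsObservable C k → (ρ₁ k).re < 0 ∧ (ρ₂ k).re < 0)
    (w₀ : Fin n → ℝ) {Θ : Matrix (Fin n) (Fin n) ℂ} {μ : Fin n → ℝ}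
    (hΘ : IsOutputDiagonalization C Θ μ) :
    IntegrableOn (fun t => (outputResponse o g L C t *ᵥ w₀) ⬝ᵥ (outputResponse o g L C t *ᵥ w₀))
        (Set.Ioi 0) ∧
      ((performance fun t => outputResponse o g L C t *ᵥ w₀ : ℝ) : ℂ) =
        Matrix.trace (D.sigmaQ w₀ * D.Psi o g Θ μ) := by
  have H := D.hasPairing_output o g hC hρ hneg w₀
  have hsq (i : Fin q) (t : ℝ) : star (((outputResponse o g L C t *ᵥ w₀) i : ℝ) : ℂ) *
      (((outputResponse o g L C t *ᵥ w₀) i : ℝ) : ℂ) =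
      (((outputResponse o g L C t *ᵥ w₀) i * (outputResponse o g L C t *ᵥ w₀) i : ℝ) : ℂ) := by
    rw [Complex.star_def, Complex.conj_ofReal, Complex.ofReal_mul]
  have hint (i : Fin q) : IntegrableOn (fun t => (outputResponse o g L C t *ᵥ w₀) i *
      (outputResponse o g L C t *ᵥ w₀) i) (Set.Ioi 0) := by
    have h := (H i).1.re
    simp only [hsq] at h
    exact h
  refine ⟨integrable_finsetSum _ fun i _ => hint i, ?_⟩
  simp only [performance, dotProduct]
  rw [integral_finsetSum _ fun i _ => hint i, Complex.ofReal_sum, trace_sigmaQ_mul]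
  have h1 (i : Fin q) := (H i).2
  simp only [hsq, integral_complex_ofReal] at h1
  rw [Finset.sum_congr rfl fun i _ => h1 i, Finset.sum_comm]
  refine Finset.sum_congr rfl fun x _ => ?_
  rw [Finset.sum_comm]
  refine Finset.sum_congr rfl fun y _ => ?_
  rw [← Finset.mul_sum, Psi, of_apply]
  congr 1
  rw [Finset.sum_comm]
  refine Finset.sum_congr rfl fun p _ => ?_
  rw [Finset.sum_comm]
  refine Finset.sum_congr rfl fun a _ => ?_
  rw [D.nu_eq hΘ, Finset.sum_mul]

end JordanDecomposition

/-- The constant coefficient of the characteristic polynomial of a block with `Re a > 0` does not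
vanish. -/
theorem Gains.Admissible.kp_add_ne_zero {g : Gains} (hg : g.Admissible) {a : ℂ} (ha : 0 < a.re) :
    (g.kp + g.γp * a : ℂ) ≠ 0 := by
  intro h
  have h1 : g.kp + g.γp * a.re = 0 := by simpa using congrArg Complex.re h
  have h2 := mul_nonneg hg.γp_nonneg ha.le
  have h3 := hg.kp_nonneg
  rcases hg.position_feedback with h4 | h4
  · exact h4 (by linarith)
  · exact (mul_ne_zero h4 ha.ne') (by linarith)

end DoubleIntegratorNetwork

theorem mainTheorem2 {n q m : ℕ} [NeZero n]
    (b : Matrix (Fin n) (Fin n) ℝ) (hb : IsDigraphWeight b) (hreach : HasGloballyReachableNode b)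
    (g : Gains) (hg : g.Admissible) (o : OutputKind)
    (C : Matrix (Fin q) (Fin n) ℝ) (hC : Matrix.mulVec C 1 = 0)
    (hstab : IOStable (outputResponse o g (laplacian b) C))
    (w₀ : Fin n → ℝ)
    (D : JordanDecomposition (laplacian b) m)
    (Θ : Matrix (Fin n) (Fin n) ℂ) (μ : Fin n → ℝ) (hΘ : IsOutputDiagonalization C Θ μ)
    (ρ₁ ρ₂ : Fin m → ℂ) (hρ : ∀ k, AreRoots g (D.eig k.succ) (ρ₁ k) (ρ₂ k)) :
    -- the performance is finite and given by the trace formula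
    (MeasureTheory.IntegrableOn
        (fun t => dotProduct (Matrix.mulVec (outputResponse o g (laplacian b) C t) w₀)
          (Matrix.mulVec (outputResponse o g (laplacian b) C t) w₀)) (Set.Ioi 0) ∧
      ((performance fun t => Matrix.mulVec (outputResponse o g (laplacian b) C t) w₀ : ℝ) : ℂ) =
        Matrix.trace (D.sigmaQ w₀ * D.Psi o g Θ μ)) ∧
    -- the observable blocks are stable
    (∀ k, D.IsObservable C k → (ρ₁ k).re < 0 ∧ (ρ₂ k).re < 0) ∧
    -- the scalar products of the stable blocks
    (∀ k l, (ρ₁ k).re < 0 → (ρ₂ k).re < 0 → (ρ₁ l).re < 0 → (ρ₂ l).re < 0 →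
      ∀ (p q : Fin (D.size k.succ)) (a b : Fin (D.size l.succ)), p ≤ q → a ≤ b →
      ∀ σ υ : ℕ, σ = q.val - p.val + 1 → υ = b.val - a.val + 1 →
        MeasureTheory.IntegrableOn
          (fun t => star (D.blockResponse o g k t p q) * D.blockResponse o g l t a b)
          (Set.Ioi 0) ∧
        (ρ₁ k ≠ ρ₂ k → ρ₁ l ≠ ρ₂ l →
          D.scalarProduct o g l k a b p q =
            ∑ ζ ∈ Finset.Icc 1 σ, ∑ r ∈ Finset.Icc 1 υ,
              (Phi ζ r σ υ * star (coeffDistinct o g σ (ρ₁ k) (ρ₂ k) ζ) *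
                  coeffDistinct o g υ (ρ₁ l) (ρ₂ l) r /
                  (star (ρ₁ k) + ρ₁ l) ^ (σ + υ - ζ - r + 1) +
                Phi ζ r σ υ * star (coeffDistinct o g σ (ρ₁ k) (ρ₂ k) ζ) *
                  coeffDistinct o g υ (ρ₁ l) (ρ₂ l) (r + υ) /
                  (star (ρ₁ k) + ρ₂ l) ^ (σ + υ - ζ - r + 1) +
                Phi ζ r σ υ * star (coeffDistinct o g σ (ρ₁ k) (ρ₂ k) (ζ + σ)) *
                  coeffDistinct o g υ (ρ₁ l) (ρ₂ l) r /
                  (star (ρ₂ k) + ρ₁ l) ^ (σ + υ - ζ - r + 1) +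
                Phi ζ r σ υ * star (coeffDistinct o g σ (ρ₁ k) (ρ₂ k) (ζ + σ)) *
                  coeffDistinct o g υ (ρ₁ l) (ρ₂ l) (r + υ) /
                  (star (ρ₂ k) + ρ₂ l) ^ (σ + υ - ζ - r + 1))) ∧
        (ρ₁ k ≠ ρ₂ k → ρ₁ l = ρ₂ l →
          D.scalarProduct o g l k a b p q =
            ∑ ζ ∈ Finset.Icc 1 σ, ∑ r ∈ Finset.Icc 1 (2 * υ),
              ((-1) ^ υ * Phi ζ r σ (2 * υ) * star (coeffDistinct o g σ (ρ₁ k) (ρ₂ k) ζ) *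
                  coeffRepeated o g υ (ρ₁ l) r /
                  (star (ρ₁ k) + ρ₁ l) ^ (σ + 2 * υ - ζ - r + 1) +
                (-1) ^ υ * Phi ζ r σ (2 * υ) * star (coeffDistinct o g σ (ρ₁ k) (ρ₂ k) (ζ + σ)) *
                  coeffRepeated o g υ (ρ₁ l) r /
                  (star (ρ₂ k) + ρ₁ l) ^ (σ + 2 * υ - ζ - r + 1))) ∧
        (ρ₁ k = ρ₂ k → ρ₁ l ≠ ρ₂ l →
          D.scalarProduct o g l k a b p q =
            ∑ ζ ∈ Finset.Icc 1 (2 * σ), ∑ r ∈ Finset.Icc 1 υ,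
              ((-1) ^ σ * Phi ζ r (2 * σ) υ * star (coeffRepeated o g σ (ρ₁ k) ζ) *
                  coeffDistinct o g υ (ρ₁ l) (ρ₂ l) r /
                  (star (ρ₁ k) + ρ₁ l) ^ (2 * σ + υ - ζ - r + 1) +
                (-1) ^ σ * Phi ζ r (2 * σ) υ * star (coeffRepeated o g σ (ρ₁ k) ζ) *
                  coeffDistinct o g υ (ρ₁ l) (ρ₂ l) (r + υ) /
                  (star (ρ₁ k) + ρ₂ l) ^ (2 * σ + υ - ζ - r + 1))) ∧
        (ρ₁ k = ρ₂ k → ρ₁ l = ρ₂ l →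
          D.scalarProduct o g l k a b p q =
            ∑ ζ ∈ Finset.Icc 1 (2 * σ), ∑ r ∈ Finset.Icc 1 (2 * υ),
              (-1) ^ (σ + υ) * Phi ζ r (2 * σ) (2 * υ) * star (coeffRepeated o g σ (ρ₁ k) ζ) *
                coeffRepeated o g υ (ρ₁ l) r /
                (star (ρ₁ k) + ρ₁ l) ^ (2 * σ + 2 * υ - ζ - r + 1))) := by

  have hneg : ∀ k, D.IsObservable C k → (ρ₁ k).re < 0 ∧ (ρ₂ k).re < 0 := fun k hk =>
    D.re_neg_of_isObservable o g hstab hk (hρ k)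
      (hg.kp_add_ne_zero (D.eig_succ_re_pos hb hreach k))
  refine ⟨D.performance_eq_trace o g (D.map_mul_R_zero hC hb hreach) hρ hneg w₀ hΘ, hneg, ?_⟩
  intro k l hk₁ hk₂ hl₁ hl₂ p q a b hpq hab σ υ hσ hυ
  refine ⟨?_, fun hk hl => ?_, fun hk hl => ?_, fun hk hl => ?_, fun hk hl => ?_⟩
  · obtain ⟨I, hI⟩ := exists_hasPairing o (hρ k) (hρ l) hk₁ hk₂ hl₁ hl₂ hpq hab
    exact hI.1
  · exact (hasPairing_of_ne_of_ne o (hρ k) (hρ l) hk₁ hk₂ hl₁ hl₂ hpq hab hσ hυ hk hl).2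
  · exact (hasPairing_of_ne_of_eq o (hρ k) (by simpa only [← hl] using hρ l) hk₁ hk₂ hl₁ hpq hab
      hσ hυ hk).2
  · exact (hasPairing_of_eq_of_ne o (by simpa only [← hk] using hρ k) (hρ l) hk₁ hl₁ hl₂ hpq hab
      hσ hυ hl).2
  · exact (hasPairing_of_eq_of_eq o (by simpa only [← hk] using hρ k)
      (by simpa only [← hl] using hρ l) hk₁ hl₁ hpq hab hσ hυ).2
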